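/- Let $n\ge 2$, let $\lambda$ be Lebesgue measure on $\mathbb{R}^n$, and let $U$ be the fundamental solution of $-\Delta$ on $\mathbb{R}^n$ (so $U(x)=-\frac1{2\pi}\log|x|$ if $n=2$ and $U(x)=\frac{1}{n(n-2)\lambda(B_1(0))}|x|^{2-n}$ if $n\ge 3$), with $U(0)=+\infty$. Let $K\subset\mathbb{R}^n$ be a Greenian domain, that is, a nonempty open connected set such that for every $y\in K$ the function $U(\cdot-y)$ has a greatest harmonic minorant $h_y$ on $K$ (a harmonic minorant dominating all subharmonic minorants). Its Green function is $G_K(x,y)=U(x-y)-h_y(x)\in[0,+\infty]$ for $x,y\in K$, and $G_K(x,y)=0$ if $x\notin K$ or $y\notin K$. The Green potential of a positive measure $\mu$ is $G_K\mu(x)=\int G_K(x,y)\,d\mu(y)$, and for a signed measure $\mu=\mu^+-\mu^-$ it is $G_K\mu=G_K\mu^+-G_K\mu^-$. Let $x^0\in K$, $\alpha>0$, and let $D\subset K$ be open. We say that $D$ is a harmonic ball relative to $K$ with center $x^0$ and size $\alpha$ if for every signed Radon measure $\mu$ with compact support contained in $K\setminus D$ the function $h=G_K\mu$ is Lebesgue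 integrable on $D$ and $\int_D h\,d\lambda=\alpha h(x^0)$. We say that $D$ is a subharmonic ball relative to $K$ with center $x^0$ and size $\alpha$ if for every signed Radon measure $\mu$ with compact support contained in $K$ and with $\mu|_D\le 0$ the function $s=G_K\mu$ is Lebesgue integrable on $D$ and $\int_D s\,d\lambda\ge\alpha s(x^0)$. (All values are extended real, and where an indeterminate difference $\infty-\infty$ occurs it is assigned the value $-\infty$.) Define $$u_K=\alpha\,G_K(x^0,\cdot)-G_K(\lambda|_D)\quad\text{on }K.$$ Then: (a) $D$ is a harmonic ball relative to $K$ with center $x^0$ and size $\alpha$ if and only if $u_K=0$ on $K\setminus D$. (b) $D$ is a subharmonic ball relative to $K$ with center $x^0$ and size $\alpha$ if and only if $u_K\ge 0$ on $K$ and $u_K=0$ on $K\setminus D$. -/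

import Mathlib

open MeasureTheory Set

noncomputable section

namespace PotentialTheory

/-- The Lebesgue integral of an extended real function: integral of the positive part minus
integral of the negative part. -/
def eintegral {X : Type*} [MeasurableSpace X] (f : X → EReal) (μ : Measure X) : EReal :=
  ((∫⁻ x, (f x).toENNReal ∂μ : ENNReal) : EReal) -
    ((∫⁻ x, (-f x).toENNReal ∂μ : ENNReal) : EReal)

/-- Lebesgue integrability of an extended real function. -/
def EIntegrable {X : Type*} [MeasurableSpace X] (f : X → EReal) (μ : Measure X) : Prop :=
  AEMeasurable f μ ∧ ∫⁻ x, (f x).toENNReal ∂μ ≠ ⊤ ∧ ∫⁻ x, (-f x).toENNReal ∂μ ≠ ⊤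

/-- The fundamental solution of `-Δ` on `ℝⁿ`, `n ≥ 2`, with value `+∞` at the origin. -/
def fundamentalSolution {n : ℕ} (x : EuclideanSpace ℝ (Fin n)) : EReal :=
  if x = 0 then ⊤
  else if n = 2 then ((-(1 / (2 * Real.pi)) * Real.log ‖x‖ : ℝ) : EReal)
  else (((1 / ((n : ℝ) * ((n : ℝ) - 2) *
      volume.real (Metric.ball (0 : EuclideanSpace ℝ (Fin n)) 1))) *
        ‖x‖ ^ (2 - (n : ℤ)) : ℝ) : EReal)

/-- Subharmonic functions on an open set `K`: upper semicontinuous, values in `[-∞, ∞)`,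
not identically `-∞` on any component, and at most their mean over every closed ball in `K`. -/
structure IsSubharmonicOn {n : ℕ} (v : EuclideanSpace ℝ (Fin n) → EReal)
    (K : Set (EuclideanSpace ℝ (Fin n))) : Prop where
  upperSemicontinuousOn : UpperSemicontinuousOn v K
  lt_top : ∀ x ∈ K, v x < ⊤
  exists_ne_bot : ∀ x ∈ K, ∃ y ∈ connectedComponentIn K x, v y ≠ ⊥
  le_mean : ∀ x ∈ K, ∀ r : ℝ, 0 < r → Metric.closedBall x r ⊆ K →
    ((volume.real (Metric.closedBall x r) : ℝ) : EReal) * v x ≤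
      eintegral v (volume.restrict (Metric.closedBall x r))

/-- `h` is the greatest harmonic minorant of `f` on `K`: a harmonic minorant which dominates
every subharmonic minorant (in particular every harmonic one). -/
structure IsGreatestHarmonicMinorant {n : ℕ} (f : EuclideanSpace ℝ (Fin n) → EReal)
    (K : Set (EuclideanSpace ℝ (Fin n))) (h : EuclideanSpace ℝ (Fin n) → ℝ) : Prop where
  harmonic : InnerProductSpace.HarmonicOnNhd h K
  le : ∀ x ∈ K, (h x : EReal) ≤ f x
  greatest : ∀ v : EuclideanSpace ℝ (Fin n) → EReal, IsSubharmonicOn v K →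
    (∀ x ∈ K, v x ≤ f x) → ∀ x ∈ K, v x ≤ (h x : EReal)

/-- An open set is Greenian if it has a Green function: for every pole `y` in the set, the
fundamental solution with pole `y` has a greatest harmonic minorant. -/
def IsGreenian {n : ℕ} (K : Set (EuclideanSpace ℝ (Fin n))) : Prop :=
  IsOpen K ∧ ∀ y ∈ K, ∃ h, IsGreatestHarmonicMinorant (fun x => fundamentalSolution (x - y)) K h

open Classical in
/-- The greatest harmonic minorant of `f` on `K` (unique on `K`), and `0` if there is none. -/
def greatestHarmonicMinorant {n : ℕ} (f : EuclideanSpace ℝ (Fin n) → EReal)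
    (K : Set (EuclideanSpace ℝ (Fin n))) : EuclideanSpace ℝ (Fin n) → ℝ :=
  if H : ∃ h, IsGreatestHarmonicMinorant f K h then H.choose else 0

open Classical in
/-- The Green function `G_K(x, y)` with pole `y`: the fundamental solution with pole `y` minus its
greatest harmonic minorant on `K`. It is `0` as soon as `x` or `y` lies outside `K`. The
difference is nonnegative for Greenian `K`, so nothing is lost by taking values in `[0, ∞]`. -/
def greenFunction {n : ℕ} (K : Set (EuclideanSpace ℝ (Fin n)))
    (x y : EuclideanSpace ℝ (Fin n)) : ENNReal :=
  if x ∈ K ∧ y ∈ K then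
    (fundamentalSolution (x - y) -
      ((greatestHarmonicMinorant (fun z => fundamentalSolution (z - y)) K x : ℝ) :
        EReal)).toENNReal
  else 0

/-- The Green potential of a positive measure. -/
def greenPotential {n : ℕ} (K : Set (EuclideanSpace ℝ (Fin n)))
    (μ : Measure (EuclideanSpace ℝ (Fin n))) (x : EuclideanSpace ℝ (Fin n)) : ENNReal :=
  ∫⁻ y, greenFunction K x y ∂μ

/-- The Green potential of a signed measure, through its Jordan decomposition. -/
def signedGreenPotential {n : ℕ} (K : Set (EuclideanSpace ℝ (Fin n)))
    (μ : SignedMeasure (EuclideanSpace ℝ (Fin n))) (x : EuclideanSpace ℝ (Fin n)) : EReal :=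
  (greenPotential K μ.toJordanDecomposition.posPart x : EReal) -
    (greenPotential K μ.toJordanDecomposition.negPart x : EReal)

/-- The signed Radon measure `μ` has compact support contained in `S`. -/
def HasCompactSupportIn {n : ℕ} (μ : SignedMeasure (EuclideanSpace ℝ (Fin n)))
    (S : Set (EuclideanSpace ℝ (Fin n))) : Prop :=
  ∃ C : Set (EuclideanSpace ℝ (Fin n)), IsCompact C ∧ C ⊆ S ∧ μ.totalVariation Cᶜ = 0

/-- Green potentials of signed measures with compact support in `K \ D`. -/
def harmonicClass {n : ℕ} (K D : Set (EuclideanSpace ℝ (Fin n))) :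
    Set (EuclideanSpace ℝ (Fin n) → EReal) :=
  {h | ∃ μ : SignedMeasure (EuclideanSpace ℝ (Fin n)),
    HasCompactSupportIn μ (K \ D) ∧ h = signedGreenPotential K μ}

/-- Green potentials of signed measures with compact support in `K` that are `≤ 0` on `D`. -/
def subharmonicClass {n : ℕ} (K D : Set (EuclideanSpace ℝ (Fin n))) :
    Set (EuclideanSpace ℝ (Fin n) → EReal) :=
  {s | ∃ μ : SignedMeasure (EuclideanSpace ℝ (Fin n)),
    HasCompactSupportIn μ K ∧ μ.restrict D ≤ 0 ∧ s = signedGreenPotential K μ}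

/-- `D` is a harmonic ball relative to `K` with center `x₀` and size `α`. -/
def IsHarmonicBall {n : ℕ} (K D : Set (EuclideanSpace ℝ (Fin n)))
    (x₀ : EuclideanSpace ℝ (Fin n)) (α : ℝ) : Prop :=
  D ⊆ K ∧ ∀ h ∈ harmonicClass K D, EIntegrable h (volume.restrict D) ∧
    eintegral h (volume.restrict D) = (α : EReal) * h x₀

/-- `D` is a subharmonic ball relative to `K` with center `x₀` and size `α`. -/
def IsSubharmonicBall {n : ℕ} (K D : Set (EuclideanSpace ℝ (Fin n)))
    (x₀ : EuclideanSpace ℝ (Fin n)) (α : ℝ) : Prop :=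
  D ⊆ K ∧ ∀ s ∈ subharmonicClass K D, EIntegrable s (volume.restrict D) ∧
    (α : EReal) * s x₀ ≤ eintegral s (volume.restrict D)

/-- `u_K = α G_K(x₀, ·) - G_K(λ|_D)`. The undefined difference `∞ - ∞` is read as `-∞`. -/
def ballPotential {n : ℕ} (K D : Set (EuclideanSpace ℝ (Fin n)))
    (x₀ : EuclideanSpace ℝ (Fin n)) (α : ℝ) (x : EuclideanSpace ℝ (Fin n)) : EReal :=
  (α : EReal) * (greenFunction K x₀ x : EReal) -
    (greenPotential K (volume.restrict D) x : EReal)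

end PotentialTheory

end

/-! Once $G_K$ is symmetric, $\int_D G_K(x,y)\,dx=G_K(\lambda|_D)(y)$, and both equivalences come
from testing on unit masses and integrating back. The mass $\delta_y$ with $y\in K\setminus D$ gives
$u_K(y)=0$ for harmonic balls and $u_K(y)\le 0$ for subharmonic ones; in the subharmonic case
$-\delta_y$ is admissible for every $y\in K$ and gives $u_K(y)\ge 0$. Conversely, Tonelli
(`lintegral_greenPotential_comm`) turns $\int_D G_K\mu^\pm$ into $\int G_K(\lambda|_D)\,d\mu^\pm$,
where the pointwise relation between $G_K(\lambda|_D)$ and $\alpha G_K(x_0,\cdot)$ applies.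

The convention $\infty-\infty=-\infty$ makes $u_K=0$ and $u_K\ge 0$ include finiteness of
$G_K(\lambda|_D)$. As $G_K(x_0,x_0)=\infty$, this forces $x_0\in D$, so a compact set in $K\setminus
D$ stays away from the pole. In the subharmonic case $\mu^-$ may charge neighbourhoods of $x_0$,
where $\alpha G_K(x_0,\cdot)$ is unbounded; integrability then rests on local boundedness of
$G_K(\lambda|_D)$ (`exists_greenPotential_le`): local integrability of the kernel nearby, Harnack
far away.

The main work is symmetry (`greatest_symm`), as $G_K$ is known only through greatest harmonic
minorants $g_y$ of $U(\cdot-y)$. If $z\mapsto g_z(y)$ is subharmonic, it is a competitor for $g_y$,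
so $g_z(y)\le g_y(z)$; exchanging the roles gives equality. Continuity and the submean inequality in
the pole follow from one comparison principle, `harmonic_le_sum_greatest_of_compact`: a harmonic
function lying below a positive finite sum of poles off a compact set containing them lies below the
same sum of the $g_z$. It combines a maximum principle (`IsSubharmonicOn.le_zero`) with an induction
removing one pole at a time. The submean inequality appears when normalised volume on a ball is
approximated by point masses. -/

noncomputable section

namespace PotentialTheory

open Metric Filter Topology InnerProductSpace Laplacian

/-! ### Mean value inequalities for C² functions -/

section MeanValue

variable {V : Type*} [NormedAddCommGroup V] [InnerProductSpace ℝ V] [FiniteDimensional ℝ V]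
  [MeasurableSpace V] [BorelSpace V]

theorem integrable_mul_of_continuousOn_closedBall {f g : V → ℝ} {r : ℝ}
    (hf : ContinuousOn f (closedBall 0 r)) (hg : Continuous g)
    (hg0 : ∀ z, r ≤ ‖z‖ → g z = 0) : Integrable (fun z => f z * g z) := by
  have h1 : IntegrableOn (fun z => f z * g z) (closedBall 0 r) :=
    (hf.mul hg.continuousOn).integrableOn_compact (isCompact_closedBall _ _)
  refine (integrableOn_iff_integrable_of_support_subset ?_).1 h1
  intro z hz
  by_contra hz'
  apply hz
  have : r ≤ ‖z‖ := by
    simp only [mem_closedBall, dist_zero_right, not_le] at hz'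
    exact hz'.le
  simp [hg0 z this]

omit [FiniteDimensional ℝ V] [MeasurableSpace V] [BorelSpace V] in
theorem hasFDerivAt_comp_normSq {Φ : ℝ → ℝ} {a : ℝ} {z : V} {ε : ℝ}
    (h : HasDerivAt Φ a (‖z‖ ^ 2 + ε)) :
    HasFDerivAt (fun z : V => Φ (‖z‖ ^ 2 + ε)) ((2 * a) • innerSL ℝ z) z := by
  have h1 : HasFDerivAt (fun z : V => ‖z‖ ^ 2 + ε) (2 • innerSL ℝ z) z :=
    (hasStrictFDerivAt_norm_sq z).hasFDerivAt.add_const ε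
  have h2 := h.comp_hasFDerivAt z h1
  refine h2.congr_fderiv ?_
  ext v
  simp only [smul_apply, innerSL_apply_apply, smul_eq_mul, nsmul_eq_mul]
  push_cast
  ring

omit [MeasurableSpace V] [BorelSpace V] in
theorem laplacian_apply (u : V → ℝ) (x : V) :
    Δ u x = ∑ i, fderiv ℝ (fderiv ℝ u) x (stdOrthonormalBasis ℝ V i)
      (stdOrthonormalBasis ℝ V i) := by
  simp [laplacian_eq_iteratedFDeriv_stdOrthonormalBasis, iteratedFDeriv_two_apply]

/-- The product of a radial weight with the radial derivative, integrated by parts. -/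
theorem integral_radial_fderiv_mul {u : V → ℝ} {x : V} {r t : ℝ} {Φ φ : ℝ → ℝ}
    (ht : t ∈ Icc (0 : ℝ) 1)
    (hu : ∀ z ∈ closedBall x r, ContDiffAt ℝ 2 u z)
    (hΦ : ∀ s, HasDerivAt Φ (-φ s) s) (hφ : Continuous φ)
    (hΦ0 : ∀ s, r ^ 2 ≤ s → Φ s = 0) (hφ0 : ∀ s, r ^ 2 ≤ s → φ s = 0) (hr : 0 < r) :
    ∫ z, fderiv ℝ u (x + t • z) z * φ (‖z‖ ^ 2) =
      (t / 2) * ∫ z, Δ u (x + t • z) * Φ (‖z‖ ^ 2) := by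
  have hΦc : Continuous Φ := continuous_iff_continuousAt.2 fun s => (hΦ s).continuousAt
  have hmem : ∀ z ∈ closedBall (0 : V) r, x + t • z ∈ closedBall x r := by
    intro z hz
    simp only [mem_closedBall, dist_zero_right, dist_self_add_left, norm_smul] at hz ⊢
    rw [Real.norm_of_nonneg ht.1]
    nlinarith [ht.2, norm_nonneg z]
  have hsq : ∀ z : V, r ≤ ‖z‖ → r ^ 2 ≤ ‖z‖ ^ 2 := fun z hz => by gcongr
  have hline : Continuous fun z : V => x + t • z := by fun_prop
  have hD1 : ContinuousOn (fun z => fderiv ℝ u (x + t • z)) (closedBall 0 r) := by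
    intro z hz
    have h1 : ContinuousAt (fderiv ℝ u) (x + t • z) :=
      ((hu _ (hmem z hz)).fderiv_right (m := 1) (by norm_num)).continuousAt
    exact (ContinuousAt.comp (f := fun z : V => x + t • z) h1
      hline.continuousAt).continuousWithinAt
  have hD2 : ContinuousOn (fun z => fderiv ℝ (fderiv ℝ u) (x + t • z)) (closedBall 0 r) := by
    intro z hz
    have h1 : ContinuousAt (fderiv ℝ (fderiv ℝ u)) (x + t • z) :=
      (((hu _ (hmem z hz)).fderiv_right (m := 1) (by norm_num)).fderiv_right (m := 0)
        (by norm_num)).continuousAt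
    exact (ContinuousAt.comp (f := fun z : V => x + t • z) h1
      hline.continuousAt).continuousWithinAt
  let e := stdOrthonormalBasis ℝ V
  have hgd : ∀ z : V, HasFDerivAt (fun z : V => Φ (‖z‖ ^ 2))
      ((2 * (-φ (‖z‖ ^ 2))) • innerSL ℝ z) z := by
    intro z
    have := hasFDerivAt_comp_normSq (ε := 0) (z := z) (by simpa using hΦ (‖z‖ ^ 2))
    simpa using this
  have hfd : ∀ i, ∀ z ∈ closedBall (0 : V) r,
      HasFDerivAt (fun z => fderiv ℝ u (x + t • z) (e i))
        (t • (fderiv ℝ (fderiv ℝ u) (x + t • z)).flip (e i)) z := by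
    intro i z hz
    have h1 : HasFDerivAt (fderiv ℝ u) (fderiv ℝ (fderiv ℝ u) (x + t • z)) (x + t • z) :=
      (((hu _ (hmem z hz)).fderiv_right (m := 1) (by norm_num)).differentiableAt
        (by norm_num)).hasFDerivAt
    have h2 : HasFDerivAt (fun z : V => x + t • z) (t • ContinuousLinearMap.id ℝ V) z :=
      ((hasFDerivAt_id z).const_smul t).const_add x
    have h3 := (h1.comp z h2).clm_apply (hasFDerivAt_const (e i) z)
    refine h3.congr_fderiv ?_
    ext v
    simp
  have hsupp : tsupport (fun z : V => Φ (‖z‖ ^ 2)) ⊆ closedBall 0 r := by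
    refine closure_minimal ?_ isClosed_closedBall
    intro z hz
    by_contra hz'
    apply hz
    refine hΦ0 _ (hsq z ?_)
    simp only [mem_closedBall, dist_zero_right, not_le] at hz'
    exact hz'.le
  -- The field `φ (‖z‖ ^ 2) • z` is $-\tfrac12$ times the gradient of `Φ (‖z‖ ^ 2)`; each coordinate
  -- is integrated by parts, and the inner derivative of `x + t • z` supplies the factor `t`.
  have ibp : ∀ i, ∫ z, fderiv ℝ u (x + t • z) (e i) * (inner ℝ z (e i) * φ (‖z‖ ^ 2)) =
      (t / 2) * ∫ z, fderiv ℝ (fderiv ℝ u) (x + t • z) (e i) (e i) * Φ (‖z‖ ^ 2) := by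
    intro i
    have key := integral_bilinear_hasFDerivAt_right_eq_neg_left_of_integrable
      (μ := (volume : Measure V)) (B := ContinuousLinearMap.mul ℝ ℝ) (v := e i)
      (f := fun z => fderiv ℝ u (x + t • z) (e i))
      (f' := fun z => t • (fderiv ℝ (fderiv ℝ u) (x + t • z)).flip (e i))
      (g := fun z : V => Φ (‖z‖ ^ 2))
      (g' := fun z : V => (2 * (-φ (‖z‖ ^ 2))) • innerSL ℝ z) ?_ ?_ ?_
      (fun z hz => hfd i z (hsupp hz)) (fun z _ => hgd z)
    · simp only [ContinuousLinearMap.mul_apply', smul_apply, smul_eq_mul,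
        ContinuousLinearMap.flip_apply, innerSL_apply_apply] at key
      have e1 : ∀ z, fderiv ℝ u (x + t • z) (e i) * (2 * -φ (‖z‖ ^ 2) * inner ℝ z (e i)) =
          (-2) * (fderiv ℝ u (x + t • z) (e i) * (inner ℝ z (e i) * φ (‖z‖ ^ 2))) := by
        intro z; ring
      have e2 : ∀ z, t * fderiv ℝ (fderiv ℝ u) (x + t • z) (e i) (e i) * Φ (‖z‖ ^ 2) =
          t * (fderiv ℝ (fderiv ℝ u) (x + t • z) (e i) (e i) * Φ (‖z‖ ^ 2)) := by
        intro z; ring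
      simp only [e1, e2, integral_const_mul] at key
      linarith
    · simp only [ContinuousLinearMap.mul_apply', smul_apply, smul_eq_mul,
        ContinuousLinearMap.flip_apply]
      refine integrable_mul_of_continuousOn_closedBall (r := r) ?_ (by fun_prop)
        (fun z hz => hΦ0 _ (hsq z hz))
      exact continuousOn_const.mul ((hD2.clm_apply continuousOn_const).clm_apply
        continuousOn_const)
    · simp only [ContinuousLinearMap.mul_apply', smul_apply, smul_eq_mul,
        innerSL_apply_apply]
      refine integrable_mul_of_continuousOn_closedBall (r := r)
        (hD1.clm_apply continuousOn_const) (by fun_prop)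
        (fun z hz => by simp [hφ0 _ (hsq z hz)])
    · simp only [ContinuousLinearMap.mul_apply']
      exact integrable_mul_of_continuousOn_closedBall (r := r)
        (hD1.clm_apply continuousOn_const) (by fun_prop) (fun z hz => hΦ0 _ (hsq z hz))
  have i1 : ∀ i, Integrable fun z =>
      fderiv ℝ u (x + t • z) (e i) * (inner ℝ z (e i) * φ (‖z‖ ^ 2)) := fun i =>
    integrable_mul_of_continuousOn_closedBall (r := r)
        (hD1.clm_apply continuousOn_const) (by fun_prop)
        (fun z hz => by simp [hφ0 _ (hsq z hz)])
  have i2 : ∀ i, Integrable fun z =>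
      fderiv ℝ (fderiv ℝ u) (x + t • z) (e i) (e i) * Φ (‖z‖ ^ 2) := fun i =>
    integrable_mul_of_continuousOn_closedBall (r := r)
        ((hD2.clm_apply continuousOn_const).clm_apply continuousOn_const) (by fun_prop)
        (fun z hz => hΦ0 _ (hsq z hz))
  have s1 : ∀ z, fderiv ℝ u (x + t • z) z * φ (‖z‖ ^ 2) =
      ∑ i, fderiv ℝ u (x + t • z) (e i) * (inner ℝ z (e i) * φ (‖z‖ ^ 2)) := by
    intro z
    conv_lhs => rw [← e.sum_repr' z]
    rw [map_sum, Finset.sum_mul]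
    refine Finset.sum_congr rfl fun i _ => ?_
    rw [map_smul, smul_eq_mul, real_inner_comm]
    rw [e.sum_repr' z]
    ring
  have s2 : ∀ z, Δ u (x + t • z) * Φ (‖z‖ ^ 2) =
      ∑ i, fderiv ℝ (fderiv ℝ u) (x + t • z) (e i) (e i) * Φ (‖z‖ ^ 2) := by
    intro z
    rw [laplacian_apply, Finset.sum_mul]
  simp only [s1, s2]
  rw [integral_finsetSum _ fun i _ => i1 i, integral_finsetSum _ fun i _ => i2 i, Finset.mul_sum]
  exact Finset.sum_congr rfl fun i _ => ibp i

/-- Supermean inequality with a smooth radial weight. -/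
theorem integral_mul_radial_le {u : V → ℝ} {x : V} {r : ℝ} {Φ φ : ℝ → ℝ} (hr : 0 < r)
    (hu : ∀ z ∈ closedBall x r, ContDiffAt ℝ 2 u z) (hΔ : ∀ z ∈ closedBall x r, Δ u z ≤ 0)
    (hΦ : ∀ s, HasDerivAt Φ (-φ s) s) (hφ : Continuous φ) (hΦ1 : ∀ s, 0 ≤ Φ s)
    (hΦ0 : ∀ s, r ^ 2 ≤ s → Φ s = 0) (hφ0 : ∀ s, r ^ 2 ≤ s → φ s = 0) :
    ∫ z in closedBall 0 r, u (x + z) * φ (‖z‖ ^ 2) ≤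
      ∫ z in closedBall (0 : V) r, u x * φ (‖z‖ ^ 2) := by
  have hmem : ∀ t ∈ Icc (0 : ℝ) 1, ∀ z ∈ closedBall (0 : V) r, x + t • z ∈ closedBall x r := by
    intro t ht z hz
    simp only [mem_closedBall, dist_zero_right, dist_self_add_left, norm_smul] at hz ⊢
    rw [Real.norm_of_nonneg ht.1]
    nlinarith [ht.2, norm_nonneg z]
  have hsq : ∀ z : V, r ≤ ‖z‖ → r ^ 2 ≤ ‖z‖ ^ 2 := fun z hz => by gcongr
  have huc : ContinuousOn u (closedBall x r) := fun z hz => (hu z hz).continuousAt.continuousWithinAt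
  have hDc : ContinuousOn (fderiv ℝ u) (closedBall x r) := fun z hz =>
    ((hu z hz).fderiv_right (m := 1) (by norm_num)).continuousAt.continuousWithinAt
  have hc : IsCompact (closedBall x r) := isCompact_closedBall _ _
  have hc0 : IsCompact (closedBall (0 : V) r) := isCompact_closedBall _ _
  obtain ⟨M, hM⟩ := hc.exists_bound_of_continuousOn huc
  obtain ⟨L, hL⟩ := hc.exists_bound_of_continuousOn hDc
  obtain ⟨N, hN⟩ := hc0.exists_bound_of_continuousOn
    (f := fun z : V => φ (‖z‖ ^ 2)) (by fun_prop)
  have hM0 : 0 ≤ M := (norm_nonneg _).trans (hM x (by simp [hr.le]))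
  have hL0 : 0 ≤ L := (norm_nonneg _).trans (hL x (by simp [hr.le]))
  -- Shrinking the ball to its centre: the claim is `A 1 ≤ A 0`. For `0 < t < 1` the derivative of
  -- `A` is $\tfrac t2\int\Delta u(x+tz)\,\Phi(\|z\|^2)\,dz\le 0$ by `integral_radial_fderiv_mul`.
  let A : ℝ → ℝ := fun t => ∫ z in closedBall (0 : V) r, u (x + t • z) * φ (‖z‖ ^ 2)
  have hmeas : ∀ t ∈ Icc (0 : ℝ) 1, AEStronglyMeasurable
      (fun z : V => u (x + t • z) * φ (‖z‖ ^ 2)) (volume.restrict (closedBall 0 r)) := by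
    intro t ht
    refine ContinuousOn.aestronglyMeasurable ?_ measurableSet_closedBall
    exact (huc.comp (by fun_prop) (hmem t ht)).mul (by fun_prop)
  have hfin : volume (closedBall (0 : V) r) < ⊤ := measure_closedBall_lt_top
  have hAc : ContinuousOn A (Icc 0 1) := by
    refine continuousOn_of_dominated (bound := fun _ => M * N) hmeas ?_ ?_ ?_
    · intro t ht
      refine (ae_restrict_iff' measurableSet_closedBall).2 (ae_of_all _ fun z hz => ?_)
      rw [norm_mul]
      exact mul_le_mul (hM _ (hmem t ht z hz)) (hN z hz) (norm_nonneg _) hM0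
    · exact integrableOn_const hfin.ne
    · refine (ae_restrict_iff' measurableSet_closedBall).2 (ae_of_all _ fun z hz => ?_)
      exact (huc.comp (by fun_prop) (fun t ht => hmem t ht z hz)).mul continuousOn_const
  have hAd : ∀ t ∈ Ioo (0 : ℝ) 1, HasDerivAt A
      (∫ z in closedBall (0 : V) r, fderiv ℝ u (x + t • z) z * φ (‖z‖ ^ 2)) t := by
    intro t ht
    have ht' := Ioo_subset_Icc_self ht
    refine (hasDerivAt_integral_of_dominated_loc_of_deriv_le (s := Ioo (0 : ℝ) 1)
      (μ := volume.restrict (closedBall (0 : V) r))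
      (F := fun t z => u (x + t • z) * φ (‖z‖ ^ 2))
      (F' := fun t z => fderiv ℝ u (x + t • z) z * φ (‖z‖ ^ 2))
      (bound := fun _ => L * r * N) (Ioo_mem_nhds ht.1 ht.2) ?_ ?_ ?_ ?_ ?_ ?_).2
    · filter_upwards [Ioo_mem_nhds ht.1 ht.2] with s hs using hmeas s (Ioo_subset_Icc_self hs)
    · exact ((huc.comp (by fun_prop) (hmem t ht')).mul (by fun_prop)).integrableOn_compact hc0
    · refine ContinuousOn.aestronglyMeasurable ?_ measurableSet_closedBall
      exact ((hDc.comp (by fun_prop) (hmem t ht')).clm_apply continuousOn_id).mul (by fun_prop)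
    · refine (ae_restrict_iff' measurableSet_closedBall).2 (ae_of_all _ fun z hz s hs => ?_)
      rw [norm_mul]
      refine mul_le_mul ?_ (hN z hz) (norm_nonneg _) (by positivity)
      refine (ContinuousLinearMap.le_opNorm _ _).trans ?_
      exact mul_le_mul (hL _ (hmem s (Ioo_subset_Icc_self hs) z hz)) (by simpa using hz)
        (norm_nonneg _) hL0
    · exact integrableOn_const hfin.ne
    · refine (ae_restrict_iff' measurableSet_closedBall).2 (ae_of_all _ fun z hz s hs => ?_)
      have h1 := ((hu _ (hmem s (Ioo_subset_Icc_self hs) z hz)).differentiableAt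
        (by norm_num)).hasFDerivAt
      have h2 : HasDerivAt (fun s : ℝ => x + s • z) z s := by
        simpa using ((hasDerivAt_id s).smul_const z).const_add x
      exact (h1.comp_hasDerivAt s h2).mul_const _
  have hanti : AntitoneOn A (Icc 0 1) := by
    refine antitoneOn_of_deriv_nonpos (convex_Icc _ _) hAc ?_ ?_
    · rw [interior_Icc]
      exact fun t ht => (hAd t ht).differentiableAt.differentiableWithinAt
    · rw [interior_Icc]
      intro t ht
      have ht' := Ioo_subset_Icc_self ht
      rw [(hAd t ht).deriv, setIntegral_eq_integral_of_forall_compl_eq_zero,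
        integral_radial_fderiv_mul ht' hu hΦ hφ hΦ0 hφ0 hr]
      · refine mul_nonpos_of_nonneg_of_nonpos (by linarith [ht.1]) ?_
        refine integral_nonpos fun z => ?_
        by_cases hz : z ∈ closedBall (0 : V) r
        · exact mul_nonpos_of_nonpos_of_nonneg (hΔ _ (hmem t ht' z hz)) (hΦ1 _)
        · simp only [mem_closedBall, dist_zero_right, not_le] at hz
          simp [hΦ0 _ (hsq z hz.le)]
      · intro z hz
        simp only [mem_closedBall, dist_zero_right, not_le] at hz
        simp [hφ0 _ (hsq z hz.le)]
  have := hanti (left_mem_Icc.2 zero_le_one) (right_mem_Icc.2 zero_le_one) zero_le_one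
  simpa [A] using this

/-- Squaring removes the kink at `0`. This provides a differentiable primitive for the piecewise
linear weights that approximate the indicator of a ball. -/
theorem hasDerivAt_sq_max_zero (s : ℝ) :
    HasDerivAt (fun s : ℝ => (max s 0) ^ 2) (2 * max s 0) s := by
  rcases lt_trichotomy s 0 with h | h | h
  · have : (fun s : ℝ => (max s 0) ^ 2) =ᶠ[𝓝 s] fun _ => 0 := by
      filter_upwards [Iio_mem_nhds h] with y hy
      simp [max_eq_right (mem_Iio.1 hy).le]
    simpa [max_eq_right h.le] using (hasDerivAt_const s (0 : ℝ)).congr_of_eventuallyEq this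
  · subst h
    rw [hasDerivAt_iff_isLittleO]
    simp only [max_self, ne_eq, OfNat.ofNat_ne_zero, not_false_eq_true, zero_pow, sub_zero,
      mul_zero, smul_zero]
    have h1 : (fun s : ℝ => (max s 0) ^ 2) =O[𝓝 0] fun s => s ^ 2 := by
      refine Asymptotics.isBigO_of_le _ fun s => ?_
      rw [norm_pow, norm_pow]
      gcongr
      rw [Real.norm_eq_abs, Real.norm_eq_abs, abs_of_nonneg (le_max_right _ _)]
      exact max_le (le_abs_self _) (abs_nonneg _)
    exact h1.trans_isLittleO (by simpa using Asymptotics.isLittleO_pow_id one_lt_two)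
  · have : (fun s : ℝ => (max s 0) ^ 2) =ᶠ[𝓝 s] fun s => s ^ 2 := by
      filter_upwards [Ioi_mem_nhds h] with y hy
      simp [max_eq_left (mem_Ioi.1 hy).le]
    simpa [max_eq_left h.le] using (hasDerivAt_pow 2 s).congr_of_eventuallyEq this

/-- Supermean inequality for `C²` functions with nonpositive Laplacian. -/
theorem setIntegral_closedBall_le_of_laplacian_nonpos {u : V → ℝ} {x : V} {r : ℝ} (hr : 0 < r)
    (hu : ∀ z ∈ closedBall x r, ContDiffAt ℝ 2 u z) (hΔ : ∀ z ∈ closedBall x r, Δ u z ≤ 0) :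
    ∫ z in closedBall x r, u z ≤ volume.real (closedBall x r) * u x := by
  let P : ℝ → ℝ := fun s => max s 0
  -- For `k > 0` the weight is `1` up to `r ^ 2 - 1 / k`, then falls linearly to `0` at `r ^ 2`; `Φ
  -- k` is the primitive of `-φ k` that vanishes beyond `r ^ 2`. For `k = 0` both are zero, which is
  -- harmless.
  let φ : ℕ → ℝ → ℝ := fun k s => (k : ℝ) * (P (r ^ 2 - s) - P (r ^ 2 - 1 / (k : ℝ) - s))
  let Φ : ℕ → ℝ → ℝ := fun k s =>
    (k : ℝ) / 2 * (P (r ^ 2 - s) ^ 2 - P (r ^ 2 - 1 / (k : ℝ) - s) ^ 2)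
  have hPmono : Monotone P := fun a b h => max_le_max_right 0 h
  have hP0 : ∀ s, s ≤ 0 → P s = 0 := fun s hs => max_eq_right hs
  have hk : ∀ k : ℕ, 0 ≤ 1 / (k : ℝ) := fun k => by positivity
  have hw : ∀ k : ℕ, ∫ z in closedBall 0 r, u (x + z) * φ k (‖z‖ ^ 2) ≤
      ∫ z in closedBall (0 : V) r, u x * φ k (‖z‖ ^ 2) := by
    intro k
    refine integral_mul_radial_le (Φ := Φ k) hr hu hΔ ?_ ?_ ?_ ?_ ?_
    · intro s
      have h1 := (hasDerivAt_sq_max_zero (r ^ 2 - s)).comp s ((hasDerivAt_id s).const_sub (r ^ 2))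
      have h2 := (hasDerivAt_sq_max_zero (r ^ 2 - 1 / (k : ℝ) - s)).comp s
        ((hasDerivAt_id s).const_sub (r ^ 2 - 1 / (k : ℝ)))
      refine ((h1.sub h2).const_mul ((k : ℝ) / 2)).congr_deriv ?_
      simp only [φ, P]
      ring
    · simp only [φ, P]
      fun_prop
    · intro s
      refine mul_nonneg (by positivity) (sub_nonneg.2 ?_)
      exact pow_le_pow_left₀ (le_max_right _ _) (hPmono (by linarith [hk k])) 2
    · intro s hs
      simp only [Φ, hP0 (r ^ 2 - s) (by linarith),
        hP0 (r ^ 2 - 1 / (k : ℝ) - s) (by linarith [hk k])]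
      simp
    · intro s hs
      simp only [φ, hP0 (r ^ 2 - s) (by linarith),
        hP0 (r ^ 2 - 1 / (k : ℝ) - s) (by linarith [hk k])]
      simp
  have hφb : ∀ k s, ‖φ k s‖ ≤ 1 := by
    intro k s
    rcases Nat.eq_zero_or_pos k with rfl | hkp
    · simp [φ]
    have hk1 : (k : ℝ) * (1 / k) = 1 := by field_simp
    have h0 : 0 ≤ P (r ^ 2 - s) - P (r ^ 2 - 1 / (k : ℝ) - s) :=
      sub_nonneg.2 (hPmono (by linarith [hk k]))
    have h1 : P (r ^ 2 - s) - P (r ^ 2 - 1 / (k : ℝ) - s) ≤ 1 / k := by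
      rw [sub_le_iff_le_add]
      refine max_le ?_ (add_nonneg (hk k) (le_max_right _ _))
      linarith [le_max_left (r ^ 2 - 1 / (k : ℝ) - s) 0]
    rw [Real.norm_of_nonneg (mul_nonneg (by positivity) h0)]
    calc (k : ℝ) * (P (r ^ 2 - s) - P (r ^ 2 - 1 / (k : ℝ) - s)) ≤ k * (1 / k) := by gcongr
      _ = 1 := hk1
  have hφlim : ∀ s, s < r ^ 2 → Tendsto (fun k => φ k s) atTop (𝓝 1) := by
    intro s hs
    refine tendsto_const_nhds.congr' ?_
    have h1 : ∀ᶠ k : ℕ in atTop, 1 / (k : ℝ) < r ^ 2 - s :=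
      (tendsto_one_div_atTop_nhds_zero_nat).eventually (gt_mem_nhds (by linarith))
    filter_upwards [h1, eventually_gt_atTop 0] with k hk1 hk0
    simp only [φ, P]
    rw [max_eq_left (by linarith), max_eq_left (by linarith)]
    field_simp
    ring
  have huc : ContinuousOn (fun z => u (x + z)) (closedBall 0 r) := by
    intro z hz
    have : ContinuousAt u (x + z) := (hu (x + z) (by simpa using hz)).continuousAt
    exact (ContinuousAt.comp (f := fun z : V => x + z) this (by fun_prop)).continuousWithinAt
  have hui := huc.integrableOn_compact (μ := volume) (isCompact_closedBall _ _)
  have hae : ∀ᵐ z ∂(volume.restrict (closedBall (0 : V) r)), ‖z‖ ^ 2 < r ^ 2 := by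
    have h0 : volume (sphere (0 : V) r) = 0 := Measure.addHaar_sphere_of_ne_zero _ _ hr.ne'
    refine (ae_restrict_iff' measurableSet_closedBall).2 ?_
    filter_upwards [measure_eq_zero_iff_ae_notMem.1 h0] with z hz hz'
    simp only [mem_closedBall, mem_sphere, dist_zero_right] at hz hz'
    have := lt_of_le_of_ne hz' hz
    gcongr
  have lim : ∀ f : V → ℝ, IntegrableOn f (closedBall 0 r) →
      Tendsto (fun k => ∫ z in closedBall 0 r, f z * φ k (‖z‖ ^ 2)) atTop
        (𝓝 (∫ z in closedBall 0 r, f z)) := by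
    intro f hf
    refine tendsto_integral_of_dominated_convergence (fun z => ‖f z‖) ?_ hf.norm ?_ ?_
    · intro k
      refine hf.1.mul (Continuous.aestronglyMeasurable ?_)
      simp only [φ, P]
      fun_prop
    · intro k
      refine ae_of_all _ fun z => ?_
      rw [norm_mul]
      exact mul_le_of_le_one_right (norm_nonneg _) (hφb _ _)
    · filter_upwards [hae] with z hz
      simpa using (hφlim _ hz).const_mul (f z)
  have hfin : volume (closedBall (0 : V) r) < ⊤ := measure_closedBall_lt_top
  have key := le_of_tendsto_of_tendsto' (lim _ hui)
    (lim (fun _ => u x) (integrableOn_const hfin.ne)) hw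
  have e1 : ∫ z in closedBall (0 : V) r, u (x + z) = ∫ z in closedBall x r, u z := by
    have := (measurePreserving_add_left volume x).setIntegral_preimage_emb
      (measurableEmbedding_addLeft x) u (closedBall x r)
    rw [← this]
    congr 2
    ext z
    simp
  rw [e1] at key
  simpa [Measure.real, Measure.addHaar_closedBall_center] using key

/-- Mean value property of harmonic functions over closed balls. -/
theorem setIntegral_closedBall_eq_of_harmonic {u : V → ℝ} {x : V} {r : ℝ} (hr : 0 < r)
    (hu : HarmonicOnNhd u (closedBall x r)) :
    ∫ z in closedBall x r, u z = volume.real (closedBall x r) * u x := by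
  refine le_antisymm (setIntegral_closedBall_le_of_laplacian_nonpos hr (fun z hz => (hu z hz).1)
    fun z hz => ((hu z hz).2.eq_of_nhds).le) ?_
  have := setIntegral_closedBall_le_of_laplacian_nonpos hr (fun z hz => (hu.neg z hz).1)
    fun z hz => ((hu.neg z hz).2.eq_of_nhds).le
  simp only [Pi.neg_apply, integral_neg] at this
  linarith

end MeanValue

/-! ### The fundamental solution: harmonicity, regularisation, supermean inequality -/

section Newton

variable {n : ℕ}

/-- The fundamental solution as a function of the squared norm. -/
def newtonProfile (n : ℕ) (s : ℝ) : ℝ :=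
  if n = 2 then -(1 / (4 * Real.pi)) * Real.log s
  else (1 / ((n : ℝ) * ((n : ℝ) - 2) *
      volume.real (ball (0 : EuclideanSpace ℝ (Fin n)) 1))) * s ^ (1 - (n : ℝ) / 2)

/-- The real valued fundamental solution; its value at the origin is irrelevant. -/
def newtonKernel (x : EuclideanSpace ℝ (Fin n)) : ℝ := newtonProfile n (‖x‖ ^ 2)

theorem fundamentalSolution_zero : fundamentalSolution (0 : EuclideanSpace ℝ (Fin n)) = ⊤ := by
  simp [fundamentalSolution]

theorem fundamentalSolution_of_ne_zero {x : EuclideanSpace ℝ (Fin n)} (hx : x ≠ 0) :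
    fundamentalSolution x = (newtonKernel x : EReal) := by
  have hx' : 0 < ‖x‖ := norm_pos_iff.2 hx
  simp only [fundamentalSolution, hx, if_false, newtonKernel, newtonProfile]
  split_ifs with h
  · rw [Real.log_pow]
    congr 1
    push_cast
    field_simp
    ring
  · congr 2
    rw [← Real.rpow_natCast ‖x‖ 2, ← Real.rpow_mul hx'.le, ← Real.rpow_intCast]
    congr 1
    push_cast
    ring

theorem newtonConst_pos (hn : 3 ≤ n) : 0 < 1 / ((n : ℝ) * ((n : ℝ) - 2) *
      volume.real (ball (0 : EuclideanSpace ℝ (Fin n)) 1)) := by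
  have h1 : (3 : ℝ) ≤ n := by exact_mod_cast hn
  have h2 : 0 < volume.real (ball (0 : EuclideanSpace ℝ (Fin n)) 1) :=
    ENNReal.toReal_pos (measure_ball_pos _ _ one_pos).ne' measure_ball_lt_top.ne
  have h3 : (0 : ℝ) < (n : ℝ) - 2 := by linarith
  positivity

/-- The logarithm and the powers have the same derivative up to the constant `κ`, so the later
computations need no split between `n = 2` and `n ≥ 3`. -/
theorem exists_hasDerivAt_newtonProfile (hn : 2 ≤ n) : ∃ κ : ℝ, 0 < κ ∧
    ∀ s : ℝ, 0 < s → HasDerivAt (newtonProfile n) (-κ * s ^ (-(n : ℝ) / 2)) s := by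
  rcases hn.eq_or_lt with rfl | h
  · refine ⟨1 / (4 * Real.pi), by positivity, fun s hs => ?_⟩
    have h1 := (Real.hasDerivAt_log hs.ne').const_mul (-(1 / (4 * Real.pi)))
    have h2 : newtonProfile 2 = fun s => -(1 / (4 * Real.pi)) * Real.log s := by
      ext s; simp [newtonProfile]
    rw [h2]
    refine h1.congr_deriv ?_
    rw [← Real.rpow_neg_one]
    norm_num
  · have hc := newtonConst_pos (n := n) h
    have h3 : (3 : ℝ) ≤ n := by exact_mod_cast h
    set c := 1 / ((n : ℝ) * ((n : ℝ) - 2) *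
      volume.real (ball (0 : EuclideanSpace ℝ (Fin n)) 1)) with hcdef
    refine ⟨c * ((n : ℝ) / 2 - 1), mul_pos hc (by linarith), fun s hs => ?_⟩
    have h1 := (Real.hasDerivAt_rpow_const (p := 1 - (n : ℝ) / 2) (Or.inl hs.ne')).const_mul c
    have h2 : newtonProfile n = fun s => c * s ^ (1 - (n : ℝ) / 2) := by
      ext s; simp [newtonProfile, h.ne', hcdef]
    rw [h2]
    refine h1.congr_deriv ?_
    rw [show (1 - (n : ℝ) / 2 - 1) = -(n : ℝ) / 2 by ring]
    ring

theorem contDiffAt_newtonProfile {s : ℝ} (hs : 0 < s) : ContDiffAt ℝ 2 (newtonProfile n) s := by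
  unfold newtonProfile
  split_ifs
  · exact contDiffAt_const.mul (Real.contDiffAt_log.2 hs.ne')
  · exact contDiffAt_const.mul (Real.contDiffAt_rpow_const_of_ne hs.ne')

theorem continuousAt_newtonProfile {s : ℝ} (hs : 0 < s) : ContinuousAt (newtonProfile n) s :=
  (contDiffAt_newtonProfile hs).continuousAt

theorem antitoneOn_newtonProfile (hn : 2 ≤ n) : AntitoneOn (newtonProfile n) (Ioi 0) := by
  obtain ⟨κ, hκ, h⟩ := exists_hasDerivAt_newtonProfile hn
  refine antitoneOn_of_deriv_nonpos (convex_Ioi 0)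
    (fun s hs => (h s hs).continuousAt.continuousWithinAt) ?_ ?_
  · rw [interior_Ioi]
    exact fun s hs => (h s hs).differentiableAt.differentiableWithinAt
  · rw [interior_Ioi]
    intro s hs
    rw [(h s hs).deriv]
    have : 0 < s ^ (-(n : ℝ) / 2) := Real.rpow_pos_of_pos hs _
    nlinarith

theorem tendsto_newtonProfile_zero (hn : 2 ≤ n) :
    Tendsto (newtonProfile n) (𝓝[>] 0) atTop := by
  rcases hn.eq_or_lt with rfl | h
  · have h2 : newtonProfile 2 = fun s => -(1 / (4 * Real.pi)) * Real.log s := by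
      ext s; simp [newtonProfile]
    rw [h2]
    exact Real.tendsto_log_nhdsGT_zero.const_mul_atBot_of_neg
      (neg_neg_of_pos (by positivity))
  · have hc := newtonConst_pos (n := n) h
    have h3 : (3 : ℝ) ≤ n := by exact_mod_cast h
    set c := 1 / ((n : ℝ) * ((n : ℝ) - 2) *
      volume.real (ball (0 : EuclideanSpace ℝ (Fin n)) 1)) with hcdef
    have h2 : newtonProfile n = fun s => c * s ^ (1 - (n : ℝ) / 2) := by
      ext s; simp [newtonProfile, h.ne', hcdef]
    rw [h2]
    exact (tendsto_rpow_neg_nhdsGT_zero (by linarith)).const_mul_atTop hc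

theorem measurable_newtonKernel : Measurable (newtonKernel (n := n)) := by
  unfold newtonKernel newtonProfile
  split_ifs <;> fun_prop

theorem continuousAt_newtonKernel {x : EuclideanSpace ℝ (Fin n)} (hx : x ≠ 0) :
    ContinuousAt newtonKernel x := by
  have hx' : 0 < ‖x‖ ^ 2 := by positivity
  exact ContinuousAt.comp (f := fun x : EuclideanSpace ℝ (Fin n) => ‖x‖ ^ 2)
    (continuousAt_newtonProfile hx') (by fun_prop)

theorem newtonKernel_neg (x : EuclideanSpace ℝ (Fin n)) :
    newtonKernel (-x) = newtonKernel x := by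
  simp [newtonKernel]

theorem newtonKernel_sub_comm (x y : EuclideanSpace ℝ (Fin n)) :
    newtonKernel (x - y) = newtonKernel (y - x) := by
  rw [← newtonKernel_neg, neg_sub]

theorem le_newtonKernel (hn : 2 ≤ n) {x : EuclideanSpace ℝ (Fin n)} {R : ℝ} (hx : x ≠ 0)
    (hR : ‖x‖ ≤ R) : newtonProfile n (R ^ 2) ≤ newtonKernel x := by
  have hx' : 0 < ‖x‖ := norm_pos_iff.2 hx
  have hR' : 0 < R := hx'.trans_le hR
  refine antitoneOn_newtonProfile hn ?_ ?_ ?_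
  · exact mem_Ioi.2 (by positivity)
  · exact mem_Ioi.2 (by positivity)
  · gcongr

theorem tendsto_newtonKernel_zero (hn : 2 ≤ n) :
    Tendsto (newtonKernel (n := n)) (𝓝[≠] 0) atTop := by
  refine (tendsto_newtonProfile_zero hn).comp ?_
  refine tendsto_nhdsWithin_iff.2 ⟨?_, ?_⟩
  · have : ContinuousAt (fun x : EuclideanSpace ℝ (Fin n) => ‖x‖ ^ 2) 0 := by fun_prop
    simpa using! this.tendsto.mono_left nhdsWithin_le_nhds
  · filter_upwards [self_mem_nhdsWithin] with x hx
    have : x ≠ 0 := hx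
    exact mem_Ioi.2 (by positivity)

/-- The fundamental solution is Lipschitz away from its pole. -/
theorem exists_lipschitz_newtonKernel (hn : 2 ≤ n) {δ : ℝ} (hδ : 0 < δ) :
    ∃ L : ℝ, 0 ≤ L ∧ ∀ a b : EuclideanSpace ℝ (Fin n), δ ≤ ‖a‖ → δ ≤ ‖b‖ →
      |newtonKernel a - newtonKernel b| ≤ L * ‖a - b‖ := by
  obtain ⟨κ, hκ, h⟩ := exists_hasDerivAt_newtonProfile hn
  have h2 : (2 : ℝ) ≤ n := by exact_mod_cast hn
  -- The radial derivative has modulus $2\kappa\rho^{1-n}$, largest at $\rho=\delta$. Working with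
  -- the radii avoids the segment from `a` to `b`, which may pass near the pole.
  let L := 2 * κ * (δ ^ 2) ^ ((1 - (n : ℝ)) / 2)
  have hL : 0 ≤ L := by positivity
  refine ⟨L, hL, fun a b ha hb => ?_⟩
  have hd : ∀ ρ ∈ Ici δ, HasDerivWithinAt (fun ρ : ℝ => newtonProfile n (ρ ^ 2))
      (-κ * (ρ ^ 2) ^ (-(n : ℝ) / 2) * (2 * ρ)) (Ici δ) ρ := by
    intro ρ hρ
    have hρ' : 0 < ρ := hδ.trans_le hρ
    have := (h (ρ ^ 2) (by positivity)).comp ρ (hasDerivAt_pow 2 ρ)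
    simpa using! this.hasDerivWithinAt
  have hb' : ∀ ρ ∈ Ici δ, ‖-κ * (ρ ^ 2) ^ (-(n : ℝ) / 2) * (2 * ρ)‖ ≤ L := by
    intro ρ hρ
    have hρ' : 0 < ρ := hδ.trans_le hρ
    have hs : 0 < (ρ ^ 2) ^ (-(n : ℝ) / 2) := Real.rpow_pos_of_pos (by positivity) _
    have e : ρ = (ρ ^ 2) ^ ((1 : ℝ) / 2) := by
      rw [← Real.sqrt_eq_rpow, Real.sqrt_sq hρ'.le]
    have e2 : (ρ ^ 2) ^ (-(n : ℝ) / 2) * ρ = (ρ ^ 2) ^ ((1 - (n : ℝ)) / 2) := by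
      nth_rewrite 2 [e]
      rw [← Real.rpow_add (by positivity)]
      congr 1
      ring
    rw [Real.norm_eq_abs, show -κ * (ρ ^ 2) ^ (-(n : ℝ) / 2) * (2 * ρ) =
      -(2 * κ * ((ρ ^ 2) ^ (-(n : ℝ) / 2) * ρ)) by ring, abs_neg, abs_of_nonneg (by positivity), e2]
    refine mul_le_mul_of_nonneg_left ?_ (by positivity)
    exact Real.rpow_le_rpow_of_nonpos (by positivity) (pow_le_pow_left₀ hδ.le hρ 2) (by linarith)
  have := (convex_Ici δ).norm_image_sub_le_of_norm_hasDerivWithin_le hd hb' (mem_Ici.2 hb)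
    (mem_Ici.2 ha)
  refine (show |newtonKernel a - newtonKernel b| ≤ L * ‖‖a‖ - ‖b‖‖ from this).trans ?_
  gcongr
  exact abs_norm_sub_norm_le a b

/-- Replacing $\|x\|^2$ by $\|x\|^2+\varepsilon$ with $\varepsilon>0$ yields a smooth superharmonic
function, while $\varepsilon=0$ yields harmonicity off the pole; both are read off from one formula.
-/
theorem laplacian_newtonProfile {κ : ℝ}
    (h : ∀ s : ℝ, 0 < s → HasDerivAt (newtonProfile n) (-κ * s ^ (-(n : ℝ) / 2)) s)
    {ε : ℝ} {x : EuclideanSpace ℝ (Fin n)} (hx : 0 < ‖x‖ ^ 2 + ε) :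
    Δ (fun z : EuclideanSpace ℝ (Fin n) => newtonProfile n (‖z‖ ^ 2 + ε)) x =
      -(2 * n * κ * ε) * (‖x‖ ^ 2 + ε) ^ (-(n : ℝ) / 2 - 1) := by
  have hopen : ∀ᶠ z : EuclideanSpace ℝ (Fin n) in 𝓝 x, 0 < ‖z‖ ^ 2 + ε := by
    have : ContinuousAt (fun z : EuclideanSpace ℝ (Fin n) => ‖z‖ ^ 2 + ε) x := by fun_prop
    exact this.eventually (lt_mem_nhds hx)
  have h1 : fderiv ℝ (fun z : EuclideanSpace ℝ (Fin n) => newtonProfile n (‖z‖ ^ 2 + ε)) =ᶠ[𝓝 x]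
      fun z => (-(2 * κ) * (‖z‖ ^ 2 + ε) ^ (-(n : ℝ) / 2)) • innerSL ℝ z := by
    filter_upwards [hopen] with z hz
    rw [(hasFDerivAt_comp_normSq (h _ hz)).fderiv]
    congr 1
    ring
  have h2 : HasFDerivAt (fun z : EuclideanSpace ℝ (Fin n) =>
      -(2 * κ) * (‖z‖ ^ 2 + ε) ^ (-(n : ℝ) / 2)) _ x :=
    hasFDerivAt_comp_normSq (Φ := fun s => -(2 * κ) * s ^ (-(n : ℝ) / 2))
      ((Real.hasDerivAt_rpow_const (p := -(n : ℝ) / 2) (Or.inl hx.ne')).const_mul _)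
  have h3 := h2.smul (innerSL ℝ (E := EuclideanSpace ℝ (Fin n))).hasFDerivAt
  have h4 : fderiv ℝ (fun z : EuclideanSpace ℝ (Fin n) =>
      (-(2 * κ) * (‖z‖ ^ 2 + ε) ^ (-(n : ℝ) / 2)) • innerSL ℝ z) x = _ := h3.fderiv
  rw [laplacian_apply, h1.fderiv_eq]
  set e := stdOrthonormalBasis ℝ (EuclideanSpace ℝ (Fin n))
  have hsum : ∑ i, inner ℝ x (e i) * inner ℝ x (e i) = ‖x‖ ^ 2 := by
    rw [← e.sum_sq_inner_left x]
    exact Finset.sum_congr rfl fun i _ => by rw [sq]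
  have hs : (‖x‖ ^ 2 + ε) ^ (-(n : ℝ) / 2) =
      (‖x‖ ^ 2 + ε) * (‖x‖ ^ 2 + ε) ^ (-(n : ℝ) / 2 - 1) := by
    rw [Real.rpow_sub_one hx.ne']
    field_simp
  have hterm : ∀ i, fderiv ℝ (fun z : EuclideanSpace ℝ (Fin n) =>
      (-(2 * κ) * (‖z‖ ^ 2 + ε) ^ (-(n : ℝ) / 2)) • innerSL ℝ z) x (e i) (e i) =
      (-(2 * κ) * (‖x‖ ^ 2 + ε) ^ (-(n : ℝ) / 2)) +
      (2 * (-(2 * κ) * (-(n : ℝ) / 2 * (‖x‖ ^ 2 + ε) ^ (-(n : ℝ) / 2 - 1)))) *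
        (inner ℝ x (e i) * inner ℝ x (e i)) := by
    intro i
    have h5 : inner ℝ (e i) (e i) = (1 : ℝ) := by
      rw [real_inner_self_eq_norm_sq, e.norm_eq_one, one_pow]
    rw [h4]
    change (-(2 * κ) * (‖x‖ ^ 2 + ε) ^ (-(n : ℝ) / 2)) * inner ℝ (e i) (e i) +
      (2 * (-(2 * κ) * (-(n : ℝ) / 2 * (‖x‖ ^ 2 + ε) ^ (-(n : ℝ) / 2 - 1)))) *
        inner ℝ x (e i) * inner ℝ x (e i) = _
    rw [h5]
    ring
  rw [Finset.sum_congr rfl fun i _ => hterm i]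
  simp only [Finset.sum_add_distrib, Finset.sum_const, Finset.card_univ, Fintype.card_fin,
    finrank_euclideanSpace, nsmul_eq_mul]
  rw [← Finset.mul_sum, hsum, hs]
  ring

theorem contDiffAt_newtonProfile_normSq {ε : ℝ} {x : EuclideanSpace ℝ (Fin n)}
    (hx : 0 < ‖x‖ ^ 2 + ε) : ContDiffAt ℝ 2
      (fun z : EuclideanSpace ℝ (Fin n) => newtonProfile n (‖z‖ ^ 2 + ε)) x :=
  ContDiffAt.comp (f := fun z : EuclideanSpace ℝ (Fin n) => ‖z‖ ^ 2 + ε) x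
    (contDiffAt_newtonProfile hx) ((contDiff_norm_sq ℝ).contDiffAt.add contDiffAt_const)

theorem harmonicAt_newtonKernel (hn : 2 ≤ n) {x : EuclideanSpace ℝ (Fin n)} (hx : x ≠ 0) :
    HarmonicAt newtonKernel x := by
  obtain ⟨κ, hκ, h⟩ := exists_hasDerivAt_newtonProfile hn
  have e : newtonKernel = fun z : EuclideanSpace ℝ (Fin n) => newtonProfile n (‖z‖ ^ 2 + 0) := by
    ext z; simp [newtonKernel]
  rw [e]
  refine ⟨contDiffAt_newtonProfile_normSq (by positivity), ?_⟩
  filter_upwards [isOpen_ne.mem_nhds hx] with z hz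
  have hz' : z ≠ 0 := hz
  rw [laplacian_newtonProfile h (by positivity)]
  simp

/-- The smooth superharmonic regularisations increase to the kernel as $\varepsilon\downarrow 0$.
Their mean inequality at `p` first gives integrability through Fatou, then passes to the limit by
dominated convergence. The centre must avoid the origin, where the real-valued kernel carries no
meaningful value. -/
theorem newtonKernel_supermean (hn : 2 ≤ n) {p : EuclideanSpace ℝ (Fin n)} (hp : p ≠ 0) {r : ℝ}
    (hr : 0 < r) : IntegrableOn newtonKernel (closedBall p r) ∧
      ∫ z in closedBall p r, newtonKernel z ≤ volume.real (closedBall p r) * newtonKernel p := by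
  obtain ⟨κ, hκ, h⟩ := exists_hasDerivAt_newtonProfile hn
  have : Nonempty (Fin n) := ⟨⟨0, by omega⟩⟩
  let ε : ℕ → ℝ := fun k => 1 / ((k : ℝ) + 1)
  have hε : ∀ k, 0 < ε k := fun k => by positivity
  have hε1 : ∀ k, ε k ≤ 1 := fun k => by
    have : (0 : ℝ) ≤ k := Nat.cast_nonneg k
    exact (div_le_one (by positivity)).2 (by linarith)
  have hε0 : Tendsto ε atTop (𝓝 0) := tendsto_one_div_add_atTop_nhds_zero_nat
  let f : ℕ → EuclideanSpace ℝ (Fin n) → ℝ := fun k z => newtonProfile n (‖z‖ ^ 2 + ε k)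
  have hpos : ∀ k (z : EuclideanSpace ℝ (Fin n)), 0 < ‖z‖ ^ 2 + ε k := fun k z => by
    have := hε k; positivity
  have hfc : ∀ k, Continuous (f k) := fun k => continuous_iff_continuousAt.2 fun z =>
    (contDiffAt_newtonProfile_normSq (hpos k z)).continuousAt
  have hvol0 : volume (closedBall p r) < ⊤ := measure_closedBall_lt_top
  have hsm : ∀ k, ∫ z in closedBall p r, f k z ≤ volume.real (closedBall p r) * f k p := by
    intro k
    refine setIntegral_closedBall_le_of_laplacian_nonpos hr
      (fun z _ => contDiffAt_newtonProfile_normSq (hpos k z)) fun z _ => ?_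
    rw [laplacian_newtonProfile h (hpos k z)]
    have h1 := Real.rpow_pos_of_pos (hpos k z) (-(n : ℝ) / 2 - 1)
    have h2 := hε k
    rw [neg_mul]
    exact neg_nonpos.2 (by positivity)
  have hle : ∀ k z, z ≠ 0 → f k z ≤ newtonKernel z := by
    intro k z hz
    exact antitoneOn_newtonProfile hn (mem_Ioi.2 (by positivity)) (mem_Ioi.2 (hpos k z))
      (by linarith [hε k])
  -- `R` bounds `‖z‖ ^ 2 + ε k` on the ball for all `k`, so `m` is a common lower bound of the `f
  -- k`; subtracting it makes Fatou applicable even where the kernel is negative.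
  let R : ℝ := (‖p‖ + r) ^ 2 + 1
  let m : ℝ := newtonProfile n R
  have hm : ∀ k, ∀ z ∈ closedBall p r, m ≤ f k z := by
    intro k z hz
    refine antitoneOn_newtonProfile hn (mem_Ioi.2 (hpos k z)) (mem_Ioi.2 (by positivity)) ?_
    have h1 : ‖z‖ ≤ ‖p‖ + r := by
      have := norm_le_norm_add_norm_sub' z p
      rw [mem_closedBall, dist_eq_norm] at hz
      linarith
    have h2 : ‖z‖ ^ 2 ≤ (‖p‖ + r) ^ 2 := by gcongr
    linarith [hε1 k]
  have hae : ∀ᵐ z : EuclideanSpace ℝ (Fin n) ∂(volume.restrict (closedBall p r)),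
      z ≠ 0 ∧ z ∈ closedBall p r := by
    have h0 : ∀ᵐ z : EuclideanSpace ℝ (Fin n) ∂(volume.restrict (closedBall p r)), z ≠ 0 :=
      Measure.ae_ne _ _
    filter_upwards [h0, ae_restrict_mem measurableSet_closedBall] with z h1 h2 using ⟨h1, h2⟩
  have hlim : ∀ᵐ z ∂(volume.restrict (closedBall p r)),
      Tendsto (fun k => f k z) atTop (𝓝 (newtonKernel z)) := by
    filter_upwards [hae] with z hz
    have hz' := hz.1
    have h1 : Tendsto (fun k => ‖z‖ ^ 2 + ε k) atTop (𝓝 (‖z‖ ^ 2)) := by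
      simpa using hε0.const_add (‖z‖ ^ 2)
    exact (continuousAt_newtonProfile (n := n) (by positivity)).tendsto.comp h1
  have hfi : ∀ k, IntegrableOn (f k) (closedBall p r) := fun k =>
    (hfc k).continuousOn.integrableOn_compact (isCompact_closedBall _ _)
  have hint' : Integrable (fun z => newtonKernel z - m) (volume.restrict (closedBall p r)) := by
    refine ⟨(measurable_newtonKernel.sub_const m).aestronglyMeasurable, ?_⟩
    have hfatou : ∫⁻ z in closedBall p r, ‖newtonKernel z - m‖ₑ ≤
        liminf (fun k => ∫⁻ z in closedBall p r, ‖f k z - m‖ₑ) atTop := by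
      refine (lintegral_congr_ae ?_).trans_le (lintegral_liminf_le' fun k =>
        ((hfc k).sub continuous_const).enorm.measurable.aemeasurable)
      filter_upwards [hlim] with z hz using ((hz.sub_const m).enorm.liminf_eq).symm
    refine (hfatou.trans_lt (lt_top_iff_ne_top.2 ?_))
    · refine ne_top_of_le_ne_top (b := ENNReal.ofReal (volume.real (closedBall p r) *
        newtonKernel p - volume.real (closedBall p r) * m)) ENNReal.ofReal_ne_top ?_
      refine Filter.liminf_le_of_le (by isBoundedDefault) fun b hb => ?_
      obtain ⟨k, hk⟩ := hb.exists
      refine hk.trans ?_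
      have hnn : 0 ≤ᵐ[volume.restrict (closedBall p r)] fun z => f k z - m := by
        filter_upwards [hae] with z hz
        exact sub_nonneg.2 (hm k z hz.2)
      have hi : Integrable (fun z => f k z - m) (volume.restrict (closedBall p r)) :=
        (hfi k).sub (integrableOn_const hvol0.ne)
      have e1 : ∫⁻ z in closedBall p r, ‖f k z - m‖ₑ =
          ENNReal.ofReal (∫ z in closedBall p r, (f k z - m)) := by
        rw [ofReal_integral_eq_lintegral_ofReal hi hnn]
        refine lintegral_congr_ae ?_
        filter_upwards [hnn] with z hz
        exact Real.enorm_of_nonneg hz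
      rw [e1]
      refine ENNReal.ofReal_le_ofReal ?_
      rw [integral_sub (hfi k) (integrableOn_const hvol0.ne)]
      simp only [integral_const, measureReal_restrict_apply_univ, smul_eq_mul]
      have := hsm k
      have h3 : volume.real (closedBall p r) * f k p ≤
          volume.real (closedBall p r) * newtonKernel p :=
        mul_le_mul_of_nonneg_left (hle k p hp) measureReal_nonneg
      linarith
  have hint : IntegrableOn newtonKernel (closedBall p r) := by
    have := hint'.add (integrableOn_const (C := m) hvol0.ne)
    refine this.congr (ae_of_all _ fun z => ?_)
    simp
  refine ⟨hint, ?_⟩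
  have hconv : Tendsto (fun k => ∫ z in closedBall p r, f k z) atTop
      (𝓝 (∫ z in closedBall p r, newtonKernel z)) := by
    refine tendsto_integral_of_dominated_convergence (fun z => ‖newtonKernel z‖ + ‖m‖)
      (fun k => (hfi k).1) (hint.norm.add (integrableOn_const hvol0.ne)) ?_ hlim
    intro k
    filter_upwards [hae] with z hz
    have h1 := hm k z hz.2
    have h2 := hle k z hz.1
    rw [Real.norm_eq_abs, Real.norm_eq_abs, Real.norm_eq_abs, abs_le]
    constructor
    · linarith [neg_abs_le m, abs_nonneg (newtonKernel z)]
    · linarith [le_abs_self (newtonKernel z), abs_nonneg m]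
  refine le_of_tendsto' hconv fun k => (hsm k).trans ?_
  exact mul_le_mul_of_nonneg_left (hle k p hp) measureReal_nonneg

theorem newtonKernel_mean (hn : 2 ≤ n) {p : EuclideanSpace ℝ (Fin n)} {r : ℝ} (hr : 0 < r)
    (hp : r < ‖p‖) :
    ∫ z in closedBall p r, newtonKernel z = volume.real (closedBall p r) * newtonKernel p := by
  refine setIntegral_closedBall_eq_of_harmonic hr fun z hz => harmonicAt_newtonKernel hn ?_
  rintro rfl
  rw [mem_closedBall, dist_zero_left] at hz
  linarith

theorem setIntegral_closedBall_sub (f : EuclideanSpace ℝ (Fin n) → ℝ)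
    (x y : EuclideanSpace ℝ (Fin n)) (r : ℝ) :
    ∫ z in closedBall x r, f (z - y) = ∫ z in closedBall (x - y) r, f z := by
  rw [← (measurePreserving_sub_right volume y).setIntegral_preimage_emb
      (measurableEmbedding_subRight y) f (closedBall (x - y) r)]
  congr 2
  ext z
  simp

theorem integrableOn_closedBall_sub {f : EuclideanSpace ℝ (Fin n) → ℝ}
    {x y : EuclideanSpace ℝ (Fin n)} {r : ℝ} (hf : IntegrableOn f (closedBall (x - y) r)) :
    IntegrableOn (fun z => f (z - y)) (closedBall x r) := by
  have := ((measurePreserving_sub_right volume y).integrableOn_comp_preimage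
    (measurableEmbedding_subRight y)).2 hf
  have e : closedBall x r = (fun z => z - y) ⁻¹' closedBall (x - y) r := by
    ext z
    simp
  rwa [e]

theorem volumeReal_closedBall_sub (x y : EuclideanSpace ℝ (Fin n)) (r : ℝ) :
    volume.real (closedBall (x - y) r) = volume.real (closedBall x r) := by
  simp [Measure.real, Measure.addHaar_closedBall_center volume x,
    Measure.addHaar_closedBall_center volume (x - y)]

theorem newtonKernel_sub_supermean (hn : 2 ≤ n) {x y : EuclideanSpace ℝ (Fin n)} (hxy : x ≠ y)
    {r : ℝ} (hr : 0 < r) :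
    ∫ z in closedBall x r, newtonKernel (z - y) ≤
      volume.real (closedBall x r) * newtonKernel (x - y) := by
  rw [setIntegral_closedBall_sub, ← volumeReal_closedBall_sub x y]
  exact (newtonKernel_supermean hn (sub_ne_zero.2 hxy) hr).2

theorem newtonKernel_sub_mean (hn : 2 ≤ n) {x y : EuclideanSpace ℝ (Fin n)} {r : ℝ} (hr : 0 < r)
    (hy : y ∉ closedBall x r) :
    ∫ z in closedBall x r, newtonKernel (z - y) =
      volume.real (closedBall x r) * newtonKernel (x - y) := by
  rw [setIntegral_closedBall_sub, ← volumeReal_closedBall_sub x y]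
  refine newtonKernel_mean hn hr ?_
  rw [mem_closedBall, not_le, dist_comm, dist_eq_norm] at hy
  exact hy

theorem integrableOn_newtonKernel (hn : 2 ≤ n) (x : EuclideanSpace ℝ (Fin n)) (r : ℝ) :
    IntegrableOn newtonKernel (closedBall x r) := by
  have : Nonempty (Fin n) := ⟨⟨0, by omega⟩⟩
  obtain ⟨p, hp⟩ := exists_ne (0 : EuclideanSpace ℝ (Fin n))
  refine (newtonKernel_supermean hn hp (r := |r| + dist x p + 1) (by positivity)).1.mono_set ?_
  exact closedBall_subset_closedBall' (by linarith [le_abs_self r])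

theorem integrableOn_newtonKernel_sub (hn : 2 ≤ n) (x y : EuclideanSpace ℝ (Fin n)) (r : ℝ) :
    IntegrableOn (fun z => newtonKernel (z - y)) (closedBall x r) :=
  integrableOn_closedBall_sub (integrableOn_newtonKernel hn _ _)

end Newton

/-! ### Extended real integrals -/

section EIntegral

variable {X : Type*} [MeasurableSpace X] {μ : Measure X}

theorem eintegral_congr_ae {f g : X → EReal} (h : f =ᵐ[μ] g) : eintegral f μ = eintegral g μ := by
  unfold eintegral
  congr 2
  · exact lintegral_congr_ae (by filter_upwards [h] with x hx; rw [hx])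
  · exact lintegral_congr_ae (by filter_upwards [h] with x hx; rw [hx])

theorem eintegral_coe {f : X → ℝ} (hf : Integrable f μ) :
    eintegral (fun x => (f x : EReal)) μ = ((∫ x, f x ∂μ : ℝ) : EReal) := by
  have h1 : ∫⁻ x, ENNReal.ofReal (f x) ∂μ ≠ ⊤ := hf.lintegral_lt_top.ne
  have h2 : ∫⁻ x, ENNReal.ofReal (-f x) ∂μ ≠ ⊤ := hf.neg.lintegral_lt_top.ne
  rw [integral_eq_lintegral_pos_part_sub_lintegral_neg_part hf, EReal.coe_sub]
  have e1 : ∀ x, ((f x : EReal)).toENNReal = ENNReal.ofReal (f x) := fun x => by simp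
  have e2 : ∀ x, (-(f x : EReal)).toENNReal = ENNReal.ofReal (-f x) := fun x => by
    rw [← EReal.coe_neg]; simp
  simp only [eintegral, e1, e2]
  rw [EReal.coe_ennreal_toReal h1, EReal.coe_ennreal_toReal h2]

end EIntegral

/-! ### Subharmonic functions with finitely many poles, maximum principle, comparison with sums of
poles -/

section Subharmonic

variable {n : ℕ} {K : Set (EuclideanSpace ℝ (Fin n))}

/-- At the poles the value `⊥` makes the submean inequality trivial, and a finite set is null, so
only real-valued data off `Z` has to be checked. The case `Z = ∅` serves for continuous functions.
-/
theorem isSubharmonicOn_of_finset_poles (hn : 2 ≤ n) (hK : IsOpen K)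
    {Z : Finset (EuclideanSpace ℝ (Fin n))} {f : EuclideanSpace ℝ (Fin n) → ℝ}
    (hc : ∀ x ∈ K, x ∉ Z → ContinuousAt f x)
    (ht : ∀ z ∈ Z, Tendsto f (𝓝[≠] z) atBot)
    (hm : ∀ x ∈ K, x ∉ Z → ∀ r : ℝ, 0 < r → closedBall x r ⊆ K →
      IntegrableOn f (closedBall x r) ∧
        volume.real (closedBall x r) * f x ≤ ∫ z in closedBall x r, f z) :
    IsSubharmonicOn (fun x => if x ∈ Z then ⊥ else (f x : EReal)) K := by
  have : Nonempty (Fin n) := ⟨⟨0, by omega⟩⟩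
  refine ⟨?_, ?_, ?_, ?_⟩
  · intro x hx y hy
    refine mem_nhdsWithin_of_mem_nhds ?_
    by_cases hxZ : x ∈ Z
    · simp only [hxZ, if_true] at hy
      obtain ⟨c, hc1, hc2⟩ := EReal.lt_iff_exists_real_btwn.1 hy
      have h1 := eventually_nhdsWithin_iff.1 ((ht x hxZ).eventually (eventually_lt_atBot c))
      filter_upwards [h1] with w hw
      split_ifs with hwZ
      · exact hy
      · have : w ≠ x := fun h => hwZ (h ▸ hxZ)
        exact (EReal.coe_lt_coe_iff.2 (hw this)).trans hc2
    · simp only [hxZ, if_false] at hy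
      obtain ⟨c, hc1, hc2⟩ := EReal.lt_iff_exists_real_btwn.1 hy
      have h1 := (hc x hx hxZ).eventually (gt_mem_nhds (EReal.coe_lt_coe_iff.1 hc1))
      have h2 : ∀ᶠ w in 𝓝 x, w ∉ Z := Z.finite_toSet.isClosed.isOpen_compl.mem_nhds hxZ
      filter_upwards [h1, h2] with w hw1 hw2
      simp only [hw2, if_false]
      exact (EReal.coe_lt_coe_iff.2 hw1).trans hc2
  · intro x _
    split_ifs
    · exact bot_lt_top
    · exact EReal.coe_lt_top _
  · intro x hx
    have hopen : IsOpen (connectedComponentIn K x) := hK.connectedComponentIn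
    have hne : (connectedComponentIn K x).Nonempty := ⟨x, mem_connectedComponentIn hx⟩
    have hinf : (connectedComponentIn K x).Infinite := by
      obtain ⟨y, hy⟩ := hne
      exact infinite_of_mem_nhds y (hopen.mem_nhds hy)
    obtain ⟨y, hy, hyZ⟩ := (hinf.sdiff Z.finite_toSet).nonempty
    refine ⟨y, hy, ?_⟩
    have : y ∉ Z := hyZ
    simp [this]
  · intro x hx r hr hxr
    by_cases hxZ : x ∈ Z
    · simp only [hxZ, if_true]
      have h1 : 0 < volume.real (closedBall x r) :=
        ENNReal.toReal_pos (measure_closedBall_pos _ _ hr).ne' measure_closedBall_lt_top.ne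
      rw [EReal.coe_mul_bot_of_pos h1]
      exact bot_le
    · have hae : (fun w => if w ∈ Z then (⊥ : EReal) else (f w : EReal))
          =ᵐ[volume.restrict (closedBall x r)] fun w => (f w : EReal) := by
        refine ae_restrict_of_ae ?_
        have : ∀ᵐ w : EuclideanSpace ℝ (Fin n), w ∉ (Z : Set (EuclideanSpace ℝ (Fin n))) :=
          measure_eq_zero_iff_ae_notMem.1 (Z.finite_toSet.measure_zero _)
        filter_upwards [this] with w hw
        have hw' : w ∉ Z := hw
        simp [hw']
      obtain ⟨h1, h2⟩ := hm x hx hxZ r hr hxr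
      rw [eintegral_congr_ae hae, eintegral_coe h1]
      simp only [hxZ, if_false]
      rw [← EReal.coe_mul]
      exact EReal.coe_le_coe_iff.2 h2

/-- A subharmonic function which is nonpositive off a compact set is nonpositive. -/
theorem IsSubharmonicOn.le_zero (hn : 2 ≤ n) (hK : IsOpen K)
    {v : EuclideanSpace ℝ (Fin n) → EReal} (hv : IsSubharmonicOn v K)
    {C : Set (EuclideanSpace ℝ (Fin n))} (hC : IsCompact C) (hCK : C ⊆ K)
    (h : ∀ x ∈ K \ C, v x ≤ 0) : ∀ x ∈ K, v x ≤ 0 := by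
  have : Nonempty (Fin n) := ⟨⟨0, by omega⟩⟩
  by_contra! hcon
  obtain ⟨p, hpK, hp⟩ := hcon
  have hpC : p ∈ C := by
    by_contra hpC
    exact absurd (h p ⟨hpK, hpC⟩) (not_le.2 hp)
  have husc : UpperSemicontinuousOn v C := fun x hx y hy =>
    (hv.upperSemicontinuousOn x (hCK hx) y hy).filter_mono (nhdsWithin_mono _ hCK)
  obtain ⟨q₀, hq₀C, hq₀⟩ := husc.exists_isMaxOn ⟨p, hpC⟩ hC
  have hpos : 0 < v q₀ := hp.trans_le (hq₀ hpC)
  have hmax : ∀ x ∈ K, v x ≤ v q₀ := by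
    intro x hx
    by_cases hxC : x ∈ C
    · exact hq₀ hxC
    · exact (h x ⟨hx, hxC⟩).trans hpos.le
  lift v q₀ to ℝ using ⟨(hv.lt_top _ (hCK hq₀C)).ne, (bot_le.trans_lt hpos).ne'⟩ with M hM
  have hMpos : 0 < M := by exact_mod_cast hpos
  let S := {x ∈ C | (M : EReal) ≤ v x}
  have hScl : IsClosed S := by
    refine isClosed_of_closure_subset fun x hx => ?_
    have hxC : x ∈ C := closure_minimal (fun y hy => hy.1) hC.isClosed hx
    refine ⟨hxC, ?_⟩
    by_contra! hlt
    have h1 := husc x hxC _ hlt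
    have h2 : ∃ᶠ y in 𝓝[C] x, y ∈ S := by
      rw [frequently_nhdsWithin_iff]
      refine (mem_closure_iff_frequently.1 hx).mono fun y hy => ⟨hy, hy.1⟩
    obtain ⟨y, hy1, hy2⟩ := (h2.and_eventually h1).exists
    exact absurd hy1.2 (not_le.2 hy2)
  have hScomp : IsCompact S := hC.of_isClosed_subset hScl fun x hx => hx.1
  -- Among the points where the maximum `M` is attained, take one farthest from the origin. On the
  -- open set `W` of nearby points still farther out `v` is strictly below `M`, which contradicts
  -- the submean inequality at `q`. No connectedness of `K` is needed.
  obtain ⟨q, hqS, hq⟩ := hScomp.exists_isMaxOn ⟨q₀, hq₀C, hM.le⟩ continuous_norm.continuousOn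
  have hqK : q ∈ K := hCK hqS.1
  obtain ⟨r, hr, hrK⟩ := Metric.nhds_basis_closedBall.mem_iff.1 (hK.mem_nhds hqK)
  let W : Set (EuclideanSpace ℝ (Fin n)) := ball q r ∩ {w | ‖q‖ < ‖w‖}
  have hWo : IsOpen W := isOpen_ball.inter (isOpen_lt continuous_const continuous_norm)
  have hWne : W.Nonempty := by
    obtain ⟨e, he⟩ : ∃ e : EuclideanSpace ℝ (Fin n), ‖q + e‖ = ‖q‖ + ‖e‖ ∧ ‖e‖ = r / 2 := by
      by_cases hq0 : q = 0
      · obtain ⟨e, he⟩ := exists_norm_eq (EuclideanSpace ℝ (Fin n)) (c := r / 2) (by positivity)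
        exact ⟨e, by simp [hq0], he⟩
      · have hq' : 0 < ‖q‖ := norm_pos_iff.2 hq0
        have hcoef : 0 ≤ r / 2 / ‖q‖ := by positivity
        refine ⟨(r / 2 / ‖q‖) • q, ?_, ?_⟩
        · have : q + (r / 2 / ‖q‖) • q = (1 + r / 2 / ‖q‖) • q := by rw [add_smul, one_smul]
          rw [this, norm_smul, norm_smul, Real.norm_of_nonneg (by linarith),
            Real.norm_of_nonneg hcoef]
          ring
        · rw [norm_smul, Real.norm_of_nonneg hcoef]
          field_simp
    refine ⟨q + e, ?_, ?_⟩
    · simp only [mem_ball, dist_self_add_left, he.2]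
      linarith
    · simp only [mem_ofPred_eq, he.1, he.2]
      linarith
  have hWlt : ∀ w ∈ W, v w < M := by
    intro w hw
    have hwK : w ∈ K := hrK (ball_subset_closedBall hw.1)
    refine lt_of_le_of_ne (hmax w hwK) fun heq => ?_
    have hwC : w ∈ C := by
      by_contra hwC
      have := h w ⟨hwK, hwC⟩
      rw [heq] at this
      exact absurd this (not_le.2 hpos)
    have := hq (show w ∈ S from ⟨hwC, heq.ge⟩)
    exact absurd (show ‖q‖ < ‖w‖ from hw.2) (not_lt.2 this)
  have hmean := hv.le_mean q hqK r hr hrK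
  have hvol : volume (closedBall q r) ≠ ⊤ := measure_closedBall_lt_top.ne
  have hlt : ∫⁻ x in closedBall q r, (v x).toENNReal <
      ∫⁻ x in closedBall q r, ENNReal.ofReal M := by
    have hle : ∀ᵐ x ∂(volume.restrict (closedBall q r)), (v x).toENNReal ≤ ENNReal.ofReal M := by
      filter_upwards [ae_restrict_mem measurableSet_closedBall] with x hx
      simpa using EReal.toENNReal_le_toENNReal (hmax x (hrK hx))
    have hconst : ∫⁻ x in closedBall q r, ENNReal.ofReal M ≠ ⊤ := by
      simp only [lintegral_const, Measure.restrict_apply MeasurableSet.univ, univ_inter]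
      exact ENNReal.mul_ne_top ENNReal.ofReal_ne_top hvol
    refine lintegral_strict_mono_of_ae_le_of_ae_lt_on aemeasurable_const
      (ne_top_of_le_ne_top hconst (lintegral_mono_ae hle)) hle (s := W) ?_ ?_
    · rw [Measure.restrict_apply hWo.measurableSet,
        inter_eq_left.2 (inter_subset_left.trans ball_subset_closedBall)]
      exact (hWo.measure_pos _ hWne).ne'
    · refine ae_of_all _ fun w hw => ?_
      have h1 := hWlt w hw
      rcases le_or_gt (v w) 0 with h0 | h0
      · rw [EReal.toENNReal_of_nonpos h0]
        exact ENNReal.ofReal_pos.2 hMpos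
      · simpa using EReal.toENNReal_lt_toENNReal h0.le h1
  have hle2 : eintegral v (volume.restrict (closedBall q r)) ≤
      ((∫⁻ x in closedBall q r, (v x).toENNReal : ENNReal) : EReal) := by
    unfold eintegral
    refine EReal.sub_le_of_le_add ?_
    exact le_add_of_nonneg_right (EReal.coe_ennreal_nonneg _)
  have hvq : v q = M := le_antisymm (hmax q hqK) hqS.2
  rw [hvq] at hmean
  have h4 := (hmean.trans hle2).trans_lt (EReal.coe_ennreal_lt_coe_ennreal_iff.2 hlt)
  refine absurd h4 (not_lt.2 (le_of_eq ?_))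
  simp only [lintegral_const, Measure.restrict_apply MeasurableSet.univ, univ_inter]
  rw [mul_comm, EReal.coe_ennreal_mul, EReal.coe_ennreal_ofReal, max_eq_left hMpos.le,
    Measure.real, EReal.coe_ennreal_toReal hvol]

/-- With positive weights the poles tend to `-∞`, and the supermean inequality of each kernel
changes sign under subtraction. Such differences are the competitors in all comparison arguments. -/
theorem isSubharmonicOn_harmonic_sub_sum (hn : 2 ≤ n) (hK : IsOpen K)
    {h : EuclideanSpace ℝ (Fin n) → ℝ} (hh : HarmonicOnNhd h K)
    {Z : Finset (EuclideanSpace ℝ (Fin n))} (hZK : ∀ z ∈ Z, z ∈ K)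
    {c : EuclideanSpace ℝ (Fin n) → ℝ} (hc : ∀ z ∈ Z, 0 < c z) :
    IsSubharmonicOn (fun x => if x ∈ Z then ⊥ else
      ((h x - ∑ z ∈ Z, c z * newtonKernel (x - z) : ℝ) : EReal)) K := by
  have hcont : ∀ x z : EuclideanSpace ℝ (Fin n), x ≠ z →
      ContinuousAt (fun x => newtonKernel (x - z)) x := fun x z hxz =>
    ContinuousAt.comp (f := fun x => x - z) (continuousAt_newtonKernel (sub_ne_zero.2 hxz))
      (by fun_prop)
  have hpole : ∀ z : EuclideanSpace ℝ (Fin n),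
      Tendsto (fun x => newtonKernel (x - z)) (𝓝[≠] z) atTop := by
    intro z
    refine (tendsto_newtonKernel_zero hn).comp (tendsto_nhdsWithin_iff.2 ⟨?_, ?_⟩)
    · have : ContinuousAt (fun x => x - z) z := by fun_prop
      simpa using! this.tendsto.mono_left nhdsWithin_le_nhds
    · filter_upwards [self_mem_nhdsWithin] with x hx using sub_ne_zero.2 hx
  refine isSubharmonicOn_of_finset_poles hn hK ?_ ?_ ?_
  · intro x hx hxZ
    refine (hh x hx).1.continuousAt.sub (tendsto_finsetSum _ fun z hz => ?_)
    exact (hcont x z fun e => hxZ (e ▸ hz)).const_mul (c z)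
  · intro z hz
    have hrest : ContinuousAt (fun x => h x - ∑ w ∈ Z.erase z, c w * newtonKernel (x - w)) z := by
      refine (hh z (hZK z hz)).1.continuousAt.sub (tendsto_finsetSum _ fun w hw => ?_)
      exact (hcont z w (Finset.ne_of_mem_erase hw).symm).const_mul (c w)
    have h1 : Tendsto (fun x => -(c z * newtonKernel (x - z))) (𝓝[≠] z) atBot :=
      tendsto_neg_atTop_atBot.comp ((hpole z).const_mul_atTop (hc z hz))
    refine ((hrest.tendsto.mono_left nhdsWithin_le_nhds).add_atBot h1).congr fun x => ?_
    rw [← Finset.add_sum_erase Z _ hz]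
    ring
  · intro x hx hxZ r hr hxr
    have i1 : IntegrableOn h (closedBall x r) :=
      (hh.continuousOn.mono hxr).integrableOn_compact (isCompact_closedBall _ _)
    have i2 : ∀ z ∈ Z, Integrable (fun w => c z * newtonKernel (w - z))
        (volume.restrict (closedBall x r)) := fun z _ =>
      (integrableOn_newtonKernel_sub hn x z r).const_mul (c z)
    refine ⟨i1.sub (integrable_finsetSum _ i2), ?_⟩
    rw [integral_sub i1 (integrable_finsetSum _ i2), integral_finsetSum _ i2,
      setIntegral_closedBall_eq_of_harmonic hr (hh.mono hxr), mul_sub, Finset.mul_sum]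
    refine sub_le_sub_left (Finset.sum_le_sum fun z hz => ?_) _
    rw [integral_const_mul]
    calc c z * ∫ w in closedBall x r, newtonKernel (w - z)
        ≤ c z * (volume.real (closedBall x r) * newtonKernel (x - z)) :=
          mul_le_mul_of_nonneg_left
            (newtonKernel_sub_supermean hn (ne_of_mem_of_not_mem hz hxZ).symm hr) (hc z hz).le
      _ = _ := by ring

variable {g : EuclideanSpace ℝ (Fin n) → EuclideanSpace ℝ (Fin n) → ℝ}

/-- A harmonic minorant of a finite sum of poles is dominated by the corresponding sum of
greatest harmonic minorants. -/
theorem harmonic_le_sum_greatest (hn : 2 ≤ n) (hK : IsOpen K)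
    (hg : ∀ y ∈ K, IsGreatestHarmonicMinorant (fun x => fundamentalSolution (x - y)) K (g y))
    (Z : Finset (EuclideanSpace ℝ (Fin n))) (hZK : ∀ z ∈ Z, z ∈ K)
    (c : EuclideanSpace ℝ (Fin n) → ℝ) (hc : ∀ z ∈ Z, 0 < c z)
    {h : EuclideanSpace ℝ (Fin n) → ℝ} (hh : HarmonicOnNhd h K)
    (hle : ∀ x ∈ K, x ∉ Z → h x ≤ ∑ z ∈ Z, c z * newtonKernel (x - z)) :
    ∀ x ∈ K, h x ≤ ∑ z ∈ Z, c z * g z x := by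
  classical
  induction Z using Finset.induction_on generalizing h with
  | empty => simpa using hle
  | insert a Z haZ ih =>
    have hca : 0 < c a := hc a (Finset.mem_insert_self _ _)
    have haK : a ∈ K := hZK a (Finset.mem_insert_self _ _)
    have hZK' : ∀ z ∈ Z, z ∈ K := fun z hz => hZK z (Finset.mem_insert_of_mem hz)
    have hc' : ∀ z ∈ Z, 0 < c z := fun z hz => hc z (Finset.mem_insert_of_mem hz)
    -- Isolate the pole `a`: after division by `c a`, the function `h` minus the other poles is a
    -- subharmonic minorant of the fundamental solution at `a`, hence lies below `g a`. Then `h - c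
    -- a • g a` is harmonic and dominated by the remaining poles.
    have hsub := isSubharmonicOn_harmonic_sub_sum hn hK (hh.const_smul (c := (c a)⁻¹)) hZK'
      (c := fun z => (c a)⁻¹ * c z) (fun z hz => mul_pos (inv_pos.2 hca) (hc' z hz))
    have hmul : ∀ x, ((c a)⁻¹ • h) x - ∑ z ∈ Z, (c a)⁻¹ * c z * newtonKernel (x - z) =
        (c a)⁻¹ * (h x - ∑ z ∈ Z, c z * newtonKernel (x - z)) := by
      intro x
      simp only [Pi.smul_apply, smul_eq_mul, mul_assoc, ← Finset.mul_sum]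
      ring
    have hga := (hg a haK).greatest _ hsub ?_
    · have hstep : ∀ x ∈ K, x ∉ Z → (h - c a • g a) x ≤ ∑ z ∈ Z, c z * newtonKernel (x - z) := by
        intro x hx hxZ
        have h1 := hga x hx
        simp only [hxZ, if_false, hmul] at h1
        rw [EReal.coe_le_coe_iff, inv_mul_le_iff₀ hca] at h1
        simp only [Pi.sub_apply, Pi.smul_apply, smul_eq_mul]
        linarith
      intro x hx
      have h2 := ih hZK' hc' (hh.sub ((hg a haK).harmonic.const_smul (c := c a))) hstep x hx
      simp only [Pi.sub_apply, Pi.smul_apply, smul_eq_mul] at h2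
      rw [Finset.sum_insert haZ]
      linarith
    · intro x hx
      by_cases hxZ : x ∈ Z
      · simp [hxZ]
      by_cases hxa : x = a
      · subst hxa
        simp [fundamentalSolution_zero]
      · simp only [hxZ, if_false, hmul]
        rw [fundamentalSolution_of_ne_zero (sub_ne_zero.2 hxa), EReal.coe_le_coe_iff,
          inv_mul_le_iff₀ hca]
        have := hle x hx (by simp [hxa, hxZ])
        rw [Finset.sum_insert haZ] at this
        linarith

/-- It suffices to compare off a compact set. -/
theorem harmonic_le_sum_greatest_of_compact (hn : 2 ≤ n) (hK : IsOpen K)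
    (hg : ∀ y ∈ K, IsGreatestHarmonicMinorant (fun x => fundamentalSolution (x - y)) K (g y))
    (Z : Finset (EuclideanSpace ℝ (Fin n)))
    (c : EuclideanSpace ℝ (Fin n) → ℝ) (hc : ∀ z ∈ Z, 0 < c z)
    {h : EuclideanSpace ℝ (Fin n) → ℝ} (hh : HarmonicOnNhd h K)
    {C : Set (EuclideanSpace ℝ (Fin n))} (hC : IsCompact C) (hCK : C ⊆ K) (hZC : ∀ z ∈ Z, z ∈ C)
    (hle : ∀ x ∈ K \ C, h x ≤ ∑ z ∈ Z, c z * newtonKernel (x - z)) :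
    ∀ x ∈ K, h x ≤ ∑ z ∈ Z, c z * g z x := by
  have hZK : ∀ z ∈ Z, z ∈ K := fun z hz => hCK (hZC z hz)
  refine harmonic_le_sum_greatest hn hK hg Z hZK c hc hh fun x hx hxZ => ?_
  have := (isSubharmonicOn_harmonic_sub_sum hn hK hh hZK hc).le_zero hn hK hC hCK ?_ x hx
  · simp only [hxZ, if_false] at this
    have h2 : h x - ∑ z ∈ Z, c z * newtonKernel (x - z) ≤ 0 := by exact_mod_cast this
    linarith
  · intro w hw
    have hwZ : w ∉ Z := fun hwZ => hw.2 (hZC w hwZ)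
    simp only [hwZ, if_false]
    have := hle w hw
    exact_mod_cast sub_nonpos.2 this

end Subharmonic

/-- Lets the image of a measure under a simple function be used as a finite weighted system of
poles. -/
theorem SimpleFunc.integral_comp_eq_sum {X E : Type*} [MeasurableSpace X] (μ : Measure X)
    [IsFiniteMeasure μ] (F : SimpleFunc X E) (f : E → ℝ) :
    ∫ z, f (F z) ∂μ = ∑ e ∈ F.range, μ.real (F ⁻¹' {e}) * f e := by
  classical
  have h : ∀ z, f (F z) = ∑ e ∈ F.range, (F ⁻¹' {e}).indicator (fun _ => f e) z := by
    intro z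
    rw [Finset.sum_eq_single (F z)]
    · simp
    · intro e _ he
      exact indicator_of_notMem (fun hz => he (Eq.symm hz)) _
    · intro hz
      exact absurd (F.mem_range_self z) hz
  simp_rw [h]
  rw [integral_finsetSum]
  · refine Finset.sum_congr rfl fun e _ => ?_
    rw [integral_indicator_const _ (F.measurableSet_fiber e), smul_eq_mul]
  · intro e _
    exact (integrable_const _).indicator (F.measurableSet_fiber e)

theorem fundamentalSolution_neg {n : ℕ} (x : EuclideanSpace ℝ (Fin n)) :
    fundamentalSolution (-x) = fundamentalSolution x := by
  simp [fundamentalSolution]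

/-! ### Dependence of the greatest harmonic minorant on the pole, and symmetry -/

section Symmetry

variable {n : ℕ} {K : Set (EuclideanSpace ℝ (Fin n))}
  {g : EuclideanSpace ℝ (Fin n) → EuclideanSpace ℝ (Fin n) → ℝ}

theorem greatest_le_newtonKernel
    (hg : ∀ y ∈ K, IsGreatestHarmonicMinorant (fun x => fundamentalSolution (x - y)) K (g y))
    {x y : EuclideanSpace ℝ (Fin n)} (hx : x ∈ K) (hy : y ∈ K) (hxy : x ≠ y) :
    g y x ≤ newtonKernel (x - y) := by
  have := (hg y hy).le x hx
  rwa [fundamentalSolution_of_ne_zero (sub_ne_zero.2 hxy), EReal.coe_le_coe_iff] at this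

/-- The greatest harmonic minorants depend on the pole in a Lipschitz way. -/
theorem exists_lipschitz_greatest (hn : 2 ≤ n) (hK : IsOpen K)
    (hg : ∀ y ∈ K, IsGreatestHarmonicMinorant (fun x => fundamentalSolution (x - y)) K (g y))
    {C S : Set (EuclideanSpace ℝ (Fin n))} (hC : IsCompact C) (hCK : C ⊆ K) (hSC : S ⊆ C)
    {δ : ℝ} (hδ : 0 < δ) (hdist : ∀ z ∈ S, ∀ w ∈ K \ C, δ ≤ ‖w - z‖) :
    ∃ L : ℝ, 0 ≤ L ∧ (∀ z ∈ S, ∀ z' ∈ S, ∀ w ∈ K \ C,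
        newtonKernel (w - z) ≤ newtonKernel (w - z') + L * ‖z - z'‖) ∧
      ∀ z ∈ S, ∀ z' ∈ S, ∀ w ∈ K, g z w ≤ g z' w + L * ‖z - z'‖ := by
  obtain ⟨L, hL, hlip⟩ := exists_lipschitz_newtonKernel hn hδ
  have h1 : ∀ z ∈ S, ∀ z' ∈ S, ∀ w ∈ K \ C,
      newtonKernel (w - z) ≤ newtonKernel (w - z') + L * ‖z - z'‖ := by
    intro z hz z' hz' w hw
    have := (abs_le.1 (hlip _ _ (hdist z hz w hw) (hdist z' hz' w hw))).2
    rw [sub_sub_sub_cancel_left, norm_sub_rev] at this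
    linarith
  refine ⟨L, hL, h1, fun z hz z' hz' w hw => ?_⟩
  -- Off `C` the kernels with poles `z` and `z'` differ by at most `L * ‖z - z'‖`, so `g z` minus
  -- this constant lies below the single pole `z'` there.
  have := harmonic_le_sum_greatest_of_compact hn hK hg {z'} (fun _ => 1) (fun _ _ => one_pos)
    (h := g z - fun _ => L * ‖z - z'‖)
    ((hg z (hCK (hSC hz))).harmonic.sub (harmonicOnNhd_const _)) hC hCK
    (fun a ha => by rw [Finset.mem_singleton.1 ha]; exact hSC hz') ?_ w hw
  · simp only [Pi.sub_apply, Finset.sum_singleton, one_mul] at this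
    linarith
  · intro w hw
    simp only [Pi.sub_apply, Finset.sum_singleton, one_mul]
    have h2 := greatest_le_newtonKernel hg hw.1 (hCK (hSC hz)) (fun e => hw.2 (e ▸ hSC hz))
    linarith [h1 z hz z' hz' w hw]

theorem exists_lipschitz_greatest_closedBall (hn : 2 ≤ n) (hK : IsOpen K)
    (hg : ∀ y ∈ K, IsGreatestHarmonicMinorant (fun x => fundamentalSolution (x - y)) K (g y))
    {x : EuclideanSpace ℝ (Fin n)} {r R : ℝ} (hrR : r < R) (hR : closedBall x R ⊆ K) :
    ∃ L : ℝ, 0 ≤ L ∧ (∀ z ∈ closedBall x r, ∀ z' ∈ closedBall x r, ∀ w ∈ K \ closedBall x R,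
        newtonKernel (w - z) ≤ newtonKernel (w - z') + L * ‖z - z'‖) ∧
      ∀ z ∈ closedBall x r, ∀ z' ∈ closedBall x r, ∀ w ∈ K, g z w ≤ g z' w + L * ‖z - z'‖ := by
  refine exists_lipschitz_greatest hn hK hg (isCompact_closedBall x R) hR
    (closedBall_subset_closedBall hrR.le) (sub_pos.2 hrR) fun z hz w hw => ?_
  have h1 : R < dist w x := by simpa using hw.2
  rw [mem_closedBall] at hz
  rw [← dist_eq_norm]
  linarith [dist_triangle w z x]

/-- The Lipschitz bound in the pole is uniform in the other variable, in which each `g p` is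
harmonic, hence continuous; a squeeze gives joint continuity. -/
theorem continuousOn_uncurry_greatest (hn : 2 ≤ n) (hK : IsOpen K)
    (hg : ∀ y ∈ K, IsGreatestHarmonicMinorant (fun x => fundamentalSolution (x - y)) K (g y)) :
    ContinuousOn (Function.uncurry g) (K ×ˢ K) := by
  rintro ⟨p, w⟩ ⟨hp, hw⟩
  obtain ⟨R, hR, hRK⟩ := Metric.nhds_basis_closedBall.mem_iff.1 (hK.mem_nhds hp)
  obtain ⟨L, hL, -, hlip⟩ := exists_lipschitz_greatest_closedBall hn hK hg (half_lt_self hR) hRK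
  have hpb : p ∈ closedBall p (R / 2) := mem_closedBall_self (by positivity)
  have hcw : ContinuousAt (fun q : EuclideanSpace ℝ (Fin n) × EuclideanSpace ℝ (Fin n) =>
      g p q.2) (p, w) :=
    ContinuousAt.comp (f := Prod.snd) ((hg p hp).harmonic w hw).1.continuousAt continuousAt_snd
  have hcn : ContinuousAt (fun q : EuclideanSpace ℝ (Fin n) × EuclideanSpace ℝ (Fin n) =>
      L * ‖q.1 - p‖) (p, w) := by fun_prop
  have hmem : ∀ᶠ q in 𝓝[K ×ˢ K] (p, w), q.1 ∈ closedBall p (R / 2) ∧ q ∈ K ×ˢ K := by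
    refine Filter.Eventually.and ?_ self_mem_nhdsWithin
    exact mem_nhdsWithin_of_mem_nhds
      (continuousAt_fst.preimage_mem_nhds (closedBall_mem_nhds p (by positivity)))
  have lower := (hcw.sub hcn).tendsto.mono_left (nhdsWithin_le_nhds (s := K ×ˢ K))
  have upper := (hcw.add hcn).tendsto.mono_left (nhdsWithin_le_nhds (s := K ×ˢ K))
  simp only [Pi.sub_apply, Pi.add_apply, sub_self, norm_zero, mul_zero, sub_zero, add_zero]
    at lower upper
  refine tendsto_of_tendsto_of_tendsto_of_le_of_le' lower upper ?_ ?_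
  · filter_upwards [hmem] with q hq
    have := hlip p hpb q.1 hq.1 q.2 hq.2.2
    rw [norm_sub_rev] at this
    simp only [Function.uncurry, Pi.sub_apply]
    linarith
  · filter_upwards [hmem] with q hq
    exact hlip q.1 hq.1 p hpb q.2 hq.2.2

/-- Submean inequality for the greatest harmonic minorant as a function of the pole. -/
theorem greatest_le_integral_pole (hn : 2 ≤ n) (hK : IsOpen K)
    (hg : ∀ y ∈ K, IsGreatestHarmonicMinorant (fun x => fundamentalSolution (x - y)) K (g y))
    {x : EuclideanSpace ℝ (Fin n)} {r : ℝ} (hr : 0 < r) (hxr : closedBall x r ⊆ K)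
    {y : EuclideanSpace ℝ (Fin n)} (hy : y ∈ K) :
    IntegrableOn (fun z => g z y) (closedBall x r) ∧
      volume.real (closedBall x r) * g x y ≤ ∫ z in closedBall x r, g z y := by
  obtain ⟨δ, hδ, hδK⟩ := (isCompact_closedBall x r).exists_cthickening_subset_open hK hxr
  rw [cthickening_closedBall hδ.le hr.le] at hδK
  obtain ⟨L, hL, hN, hlip⟩ := exists_lipschitz_greatest_closedBall hn hK hg
    (show r < δ + r by linarith) hδK
  have hxx : x ∈ closedBall x r := mem_closedBall_self hr.le
  have hcont : ContinuousOn (fun z => g z y) (closedBall x r) :=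
    (continuousOn_uncurry_greatest hn hK hg).comp (f := fun z => (z, y)) (by fun_prop)
      fun z hz => ⟨hxr hz, hy⟩
  have hgi : IntegrableOn (fun z => g z y) (closedBall x r) :=
    hcont.integrableOn_compact (isCompact_closedBall _ _)
  refine ⟨hgi, ?_⟩
  set μ := volume.restrict (closedBall x r) with hμ
  have hfin : IsFiniteMeasure μ := ⟨by
    rw [hμ, Measure.restrict_apply_univ]; exact measure_closedBall_lt_top⟩
  -- The images of Lebesgue measure on the ball under these approximations of the identity are
  -- finite sums of point masses in the ball. The Lipschitz bounds control each replacement by `L *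
  -- η k`, with `η k` the integrated displacement.
  let F : ℕ → SimpleFunc (EuclideanSpace ℝ (Fin n)) (EuclideanSpace ℝ (Fin n)) := fun k =>
    SimpleFunc.approxOn id measurable_id (closedBall x r) x hxx k
  have hFmem : ∀ k z, F k z ∈ closedBall x r := fun k z =>
    SimpleFunc.approxOn_mem measurable_id hxx k z
  have hball : ∀ᵐ z ∂μ, z ∈ closedBall x r := ae_restrict_mem measurableSet_closedBall
  have hFb : ∀ k, ∀ᵐ z ∂μ, ‖F k z - z‖ ≤ 2 * r := by
    intro k
    filter_upwards [hball] with z hz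
    have h1 := hFmem k z
    rw [mem_closedBall] at h1 hz
    rw [← dist_eq_norm]
    linarith [dist_triangle_right (F k z) z x]
  have hFm : ∀ k, AEStronglyMeasurable (fun z => ‖F k z - z‖) μ := fun k =>
    (((F k).measurable.sub measurable_id).norm).aestronglyMeasurable
  have hFi : ∀ k, Integrable (fun z => ‖F k z - z‖) μ := fun k =>
    (integrable_const (2 * r)).mono' (hFm k) (by
      filter_upwards [hFb k] with z hz
      simpa using hz)
  let η : ℕ → ℝ := fun k => ∫ z, ‖F k z - z‖ ∂μ
  have hη : Tendsto η atTop (𝓝 0) := by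
    have : Tendsto η atTop (𝓝 (∫ _, (0 : ℝ) ∂μ)) := by
      refine tendsto_integral_of_dominated_convergence (fun _ => 2 * r) hFm
        (integrable_const _) (fun k => by filter_upwards [hFb k] with z hz; simpa using hz) ?_
      filter_upwards [hball] with z hz
      have h1 : Tendsto (fun k => F k z) atTop (𝓝 (id z)) :=
        SimpleFunc.tendsto_approxOn measurable_id hxx (subset_closure hz)
      simpa using (h1.sub_const z).norm
    simpa using this
  have hFint : ∀ k (f : EuclideanSpace ℝ (Fin n) → ℝ), Integrable (fun z => f (F k z)) μ :=
    fun k f => ((F k).map f).integrable_of_isFiniteMeasure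
  have main : ∀ k, volume.real (closedBall x r) * g x y - L * η k ≤
      (∫ z, g z y ∂μ) + L * η k := by
    intro k
    let c : EuclideanSpace ℝ (Fin n) → ℝ := fun e => μ.real (F k ⁻¹' {e})
    -- Values attained only on null sets are discarded, since the comparison principle needs
    -- positive weights.
    let Z := (F k).range.filter fun e => 0 < c e
    have hZ : ∀ f : EuclideanSpace ℝ (Fin n) → ℝ,
        ∑ e ∈ Z, c e * f e = ∫ z, f (F k z) ∂μ := by
      intro f
      rw [SimpleFunc.integral_comp_eq_sum]
      refine Finset.sum_filter_of_ne fun e _ he => ?_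
      exact lt_of_le_of_ne measureReal_nonneg fun h => he (by simp [c, ← h])
    have hZC : ∀ e ∈ Z, e ∈ closedBall x r := by
      intro e he
      obtain ⟨z, rfl⟩ := SimpleFunc.mem_range.1 (Finset.mem_filter.1 he).1
      exact hFmem k z
    have h1 := harmonic_le_sum_greatest_of_compact hn hK hg Z c
      (fun e he => (Finset.mem_filter.1 he).2)
      (h := (volume.real (closedBall x r) • g x) - fun _ => L * η k)
      (((hg x (hxr hxx)).harmonic.const_smul).sub (harmonicOnNhd_const _))
      (isCompact_closedBall x (δ + r)) hδK
      (fun e he => closedBall_subset_closedBall (by linarith) (hZC e he)) ?_ y hy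
    · rw [hZ fun e => g e y] at h1
      simp only [Pi.sub_apply, Pi.smul_apply, smul_eq_mul] at h1
      refine h1.trans ?_
      rw [← integral_const_mul, ← integral_add hgi ((hFi k).const_mul L)]
      refine integral_mono_ae (hFint k fun e => g e y) (hgi.add ((hFi k).const_mul L)) ?_
      filter_upwards [hball] with z hz
      exact hlip _ (hFmem k z) z hz y hy
    · intro w hw
      have hwx : w ∉ closedBall x r := fun h =>
        hw.2 (closedBall_subset_closedBall (by linarith) h)
      rw [hZ fun e => newtonKernel (w - e)]
      simp only [Pi.sub_apply, Pi.smul_apply, smul_eq_mul]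
      have h2 : volume.real (closedBall x r) * g x w ≤
          volume.real (closedBall x r) * newtonKernel (w - x) :=
        mul_le_mul_of_nonneg_left (greatest_le_newtonKernel hg hw.1 (hxr hxx)
          fun e => hwx (e ▸ hxx)) measureReal_nonneg
      -- Outside the larger ball, the pole `x` weighted by the volume equals the potential of
      -- Lebesgue measure on the small ball, which the discrete poles match up to `L * η k`.
      have h3 := newtonKernel_sub_mean hn hr hwx
      rw [newtonKernel_sub_comm x w] at h3
      have hi : Integrable (fun z => newtonKernel (z - w)) μ :=
        integrableOn_newtonKernel_sub hn x w r
      have h4 : ∫ z, newtonKernel (z - w) ∂μ ≤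
          (∫ z, newtonKernel (w - F k z) ∂μ) + L * η k := by
        rw [← integral_const_mul, ← integral_add (hFint k fun e => newtonKernel (w - e))
          ((hFi k).const_mul L)]
        refine integral_mono_ae hi ((hFint k fun e => newtonKernel (w - e)).add
          ((hFi k).const_mul L)) ?_
        filter_upwards [hball] with z hz
        have := hN z hz _ (hFmem k z) w hw
        rw [norm_sub_rev] at this
        rw [newtonKernel_sub_comm]
        exact this
      linarith
  have l1 : Tendsto (fun k => volume.real (closedBall x r) * g x y - L * η k) atTop
      (𝓝 (volume.real (closedBall x r) * g x y)) := by
    simpa using (hη.const_mul L).const_sub (volume.real (closedBall x r) * g x y)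
  have l2 : Tendsto (fun k => (∫ z, g z y ∂μ) + L * η k) atTop (𝓝 (∫ z, g z y ∂μ)) := by
    simpa using (hη.const_mul L).const_add (∫ z, g z y ∂μ)
  exact le_of_tendsto_of_tendsto' l1 l2 main

/-- Symmetry of the regular part of the Green function. -/
theorem greatest_symm (hn : 2 ≤ n) (hK : IsOpen K)
    (hg : ∀ y ∈ K, IsGreatestHarmonicMinorant (fun x => fundamentalSolution (x - y)) K (g y))
    {x y : EuclideanSpace ℝ (Fin n)} (hx : x ∈ K) (hy : y ∈ K) : g x y = g y x := by
  have key : ∀ x ∈ K, ∀ y ∈ K, g x y ≤ g y x := by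
    intro x hx y hy
    have hcont : ∀ z ∈ K, ContinuousAt (fun z => g z y) z := fun z hz =>
      ContinuousAt.comp (f := fun z => (z, y)) ((continuousOn_uncurry_greatest hn hK hg).continuousAt
        (prod_mem_nhds (hK.mem_nhds hz) (hK.mem_nhds hy))) (by fun_prop)
    -- As a function of the pole, `g z y` is subharmonic and dominated by the fundamental solution
    -- at `y`; maximality of `g y` gives one inequality.
    have hsub := isSubharmonicOn_of_finset_poles hn hK (Z := ∅) (f := fun z => g z y)
      (fun z hz _ => hcont z hz) (by simp)
      (fun z hz _ r hr hzr => greatest_le_integral_pole hn hK hg hr hzr hy)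
    simp only [Finset.notMem_empty, if_false] at hsub
    have := (hg y hy).greatest _ hsub (fun z hz => ?_) x hx
    · exact EReal.coe_le_coe_iff.1 this
    · have := (hg z hz).le y hy
      rwa [← fundamentalSolution_neg, neg_sub] at this
  exact le_antisymm (key x hx y hy) (key y hy x hx)

end Symmetry

/-! ### The Green function: symmetry, reciprocity, Harnack inequality, local bounds -/

section Green

variable {n : ℕ} {K : Set (EuclideanSpace ℝ (Fin n))}

/-- The regular part of the Green function. -/
def greenRegularPart (K : Set (EuclideanSpace ℝ (Fin n))) (y : EuclideanSpace ℝ (Fin n)) :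
    EuclideanSpace ℝ (Fin n) → ℝ :=
  greatestHarmonicMinorant (fun z => fundamentalSolution (z - y)) K

theorem IsGreenian.isGreatest (hK : IsGreenian K) : ∀ y ∈ K,
    IsGreatestHarmonicMinorant (fun x => fundamentalSolution (x - y)) K
      (greenRegularPart K y) := by
  intro y hy
  have := hK.2 y hy
  rw [greenRegularPart, greatestHarmonicMinorant, dif_pos this]
  exact this.choose_spec

theorem greenFunction_self {x : EuclideanSpace ℝ (Fin n)} (hx : x ∈ K) :
    greenFunction K x x = ⊤ := by
  simp [greenFunction, hx, fundamentalSolution_zero]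

theorem greenFunction_of_ne {x y : EuclideanSpace ℝ (Fin n)} (hx : x ∈ K) (hy : y ∈ K)
    (hxy : x ≠ y) :
    greenFunction K x y = ENNReal.ofReal (newtonKernel (x - y) - greenRegularPart K y x) := by
  rw [greenFunction, if_pos ⟨hx, hy⟩, fundamentalSolution_of_ne_zero (sub_ne_zero.2 hxy),
    ← EReal.coe_sub, EReal.real_coe_toENNReal]
  rfl

theorem greenFunction_comm (hn : 2 ≤ n) (hK : IsGreenian K) (x y : EuclideanSpace ℝ (Fin n)) :
    greenFunction K x y = greenFunction K y x := by
  by_cases h : x ∈ K ∧ y ∈ K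
  · by_cases hxy : x = y
    · rw [hxy]
    · rw [greenFunction_of_ne h.1 h.2 hxy, greenFunction_of_ne h.2 h.1 (Ne.symm hxy),
        newtonKernel_sub_comm, greatest_symm hn hK.1 hK.isGreatest h.1 h.2]
  · rw [greenFunction, if_neg h, greenFunction, if_neg fun h' => h h'.symm]

/-- Joint measurability, required for Tonelli, comes from the joint continuity of the regular part.
The swap in the proof appears because the regular part takes the pole as its first argument. -/
theorem measurable_greenFunction (hn : 2 ≤ n) (hK : IsGreenian K) :
    Measurable (Function.uncurry (greenFunction K)) := by
  classical
  have hKm : MeasurableSet (K ×ˢ K) := hK.1.measurableSet.prod hK.1.measurableSet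
  have hreg : Measurable ((K ×ˢ K).piecewise (Function.uncurry (greenRegularPart K))
      fun _ => (0 : ℝ)) :=
    (continuousOn_uncurry_greatest hn hK.1 hK.isGreatest).measurable_piecewise
      continuousOn_const hKm
  have hdiag : MeasurableSet {p : EuclideanSpace ℝ (Fin n) × EuclideanSpace ℝ (Fin n) |
      p.1 = p.2} := measurableSet_eq_fun measurable_fst measurable_snd
  have hreal : Measurable fun p : EuclideanSpace ℝ (Fin n) × EuclideanSpace ℝ (Fin n) =>
      ENNReal.ofReal (newtonKernel (p.1 - p.2) -
        (K ×ˢ K).piecewise (Function.uncurry (greenRegularPart K)) (fun _ => (0 : ℝ)) p.swap) :=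
    ((measurable_newtonKernel.comp (measurable_fst.sub measurable_snd)).sub
      (hreg.comp measurable_swap)).ennreal_ofReal
  have hite : Measurable fun p : EuclideanSpace ℝ (Fin n) × EuclideanSpace ℝ (Fin n) =>
      if p.1 = p.2 then ⊤ else ENNReal.ofReal (newtonKernel (p.1 - p.2) -
        (K ×ˢ K).piecewise (Function.uncurry (greenRegularPart K)) (fun _ => (0 : ℝ)) p.swap) :=
    Measurable.ite hdiag measurable_const hreal
  convert hite.indicator hKm using 1
  ext ⟨x, y⟩
  by_cases h : x ∈ K ∧ y ∈ K
  · have hm : (x, y) ∈ K ×ˢ K := h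
    have hm' : (y, x) ∈ K ×ˢ K := h.symm
    rw [indicator_of_mem hm]
    by_cases hxy : x = y
    · subst hxy
      simp [greenFunction_self h.1]
    · simp [hxy, greenFunction_of_ne h.1 h.2 hxy, piecewise_eq_of_mem _ _ _ hm']
  · have hm : (x, y) ∉ K ×ˢ K := h
    rw [indicator_of_notMem hm]
    simp only [Function.uncurry, greenFunction, if_neg h]

theorem measurable_greenFunction_left (hn : 2 ≤ n) (hK : IsGreenian K)
    (x : EuclideanSpace ℝ (Fin n)) : Measurable (greenFunction K x) :=
  (measurable_greenFunction hn hK).comp measurable_prodMk_left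

theorem measurable_greenPotential (hn : 2 ≤ n) (hK : IsGreenian K)
    (ν : Measure (EuclideanSpace ℝ (Fin n))) [SFinite ν] : Measurable (greenPotential K ν) :=
  (measurable_greenFunction hn hK).lintegral_prod_right'

/-- Reciprocity for Green potentials. -/
theorem lintegral_greenPotential_comm (hn : 2 ≤ n) (hK : IsGreenian K)
    (μ ν : Measure (EuclideanSpace ℝ (Fin n))) [SFinite μ] [SFinite ν] :
    ∫⁻ x, greenPotential K ν x ∂μ = ∫⁻ y, greenPotential K μ y ∂ν := by
  unfold greenPotential
  rw [lintegral_lintegral_swap (measurable_greenFunction hn hK).aemeasurable]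
  simp_rw [greenFunction_comm hn hK]

/-- The Green function is bounded on compact sets which do not contain the pole. -/
theorem exists_greenFunction_le (hK : IsGreenian K) {x₀ : EuclideanSpace ℝ (Fin n)} (hn : 2 ≤ n)
    (hx₀ : x₀ ∈ K) {C : Set (EuclideanSpace ℝ (Fin n))} (hC : IsCompact C) (hCK : C ⊆ K)
    (hx₀C : x₀ ∉ C) : ∃ M : ENNReal, M ≠ ⊤ ∧ ∀ y ∈ C, greenFunction K x₀ y ≤ M := by
  have hne : ∀ y ∈ C, y ≠ x₀ := fun y hy e => hx₀C (e ▸ hy)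
  have hcont : ContinuousOn (fun y => newtonKernel (y - x₀) - greenRegularPart K x₀ y) C := by
    intro y hy
    refine ContinuousAt.continuousWithinAt (ContinuousAt.sub ?_ ?_)
    · exact ContinuousAt.comp (f := fun y => y - x₀)
        (continuousAt_newtonKernel (sub_ne_zero.2 (hne y hy))) (by fun_prop)
    · exact ((hK.isGreatest x₀ hx₀).harmonic y (hCK hy)).1.continuousAt
  obtain ⟨M, hM⟩ := hC.exists_bound_of_continuousOn hcont
  refine ⟨ENNReal.ofReal M, ENNReal.ofReal_ne_top, fun y hy => ?_⟩
  rw [greenFunction_comm hn hK, greenFunction_of_ne (hCK hy) hx₀ (hne y hy)]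
  exact ENNReal.ofReal_le_ofReal ((le_abs_self _).trans (hM y hy))

theorem integral_greenFunction_mean (hn : 2 ≤ n) (hK : IsGreenian K)
    {x y : EuclideanSpace ℝ (Fin n)} {r : ℝ} (hr : 0 < r) (hx : x ∈ K)
    (hy : closedBall y r ⊆ K) (hxy : x ∉ closedBall y r) :
    IntegrableOn (fun z => newtonKernel (z - x) - greenRegularPart K x z) (closedBall y r) ∧
    ∫ z in closedBall y r, (newtonKernel (z - x) - greenRegularPart K x z) =
      volume.real (closedBall y r) * (newtonKernel (y - x) - greenRegularPart K x y) := by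
  have hh := ((hK.isGreatest x hx).harmonic.mono hy)
  have i1 : IntegrableOn (greenRegularPart K x) (closedBall y r) :=
    hh.continuousOn.integrableOn_compact (isCompact_closedBall _ _)
  have i2 := integrableOn_newtonKernel_sub hn y x r
  refine ⟨i2.sub i1, ?_⟩
  rw [integral_sub i2 i1, newtonKernel_sub_mean hn hr hxy,
    setIntegral_closedBall_eq_of_harmonic hr hh]
  ring

/-- Harnack's inequality for Green functions with distant pole. -/
theorem greenFunction_harnack (hn : 2 ≤ n) (hK : IsGreenian K)
    {x y p : EuclideanSpace ℝ (Fin n)} {r : ℝ} (hr : 0 < r) (hp : closedBall p (2 * r) ⊆ K)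
    (hx : x ∈ K) (hxp : x ∉ closedBall p (2 * r)) (hy : y ∈ closedBall p r) :
    greenFunction K y x ≤ ENNReal.ofReal (volume.real (closedBall p (2 * r)) /
      volume.real (closedBall p r)) * greenFunction K p x := by
  have hsub : closedBall y r ⊆ closedBall p (2 * r) :=
    closedBall_subset_closedBall' (by rw [mem_closedBall] at hy; linarith)
  have hyp : y ∈ closedBall p (2 * r) := hsub (mem_closedBall_self hr.le)
  have hpp : p ∈ closedBall p (2 * r) := mem_closedBall_self (by linarith)
  have hne : ∀ z ∈ closedBall p (2 * r), z ≠ x := fun z hz e => hxp (e ▸ hz)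
  obtain ⟨-, e1⟩ := integral_greenFunction_mean hn hK hr hx (hsub.trans hp) fun h => hxp (hsub h)
  obtain ⟨i2, e2⟩ := integral_greenFunction_mean hn hK (by linarith) hx hp hxp
  -- Both sides are mean values of a nonnegative harmonic function over nested balls, so the Harnack
  -- constant is the ratio of the two volumes.
  have hmono : ∫ z in closedBall y r, (newtonKernel (z - x) - greenRegularPart K x z) ≤
      ∫ z in closedBall p (2 * r), (newtonKernel (z - x) - greenRegularPart K x z) := by
    refine setIntegral_mono_set i2 ?_ (LE.le.eventuallyLE hsub)
    filter_upwards [ae_restrict_mem measurableSet_closedBall] with z hz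
    exact sub_nonneg.2 (greatest_le_newtonKernel hK.isGreatest (hp hz) hx (hne z hz))
  have hvol : volume.real (closedBall y r) = volume.real (closedBall p r) := by
    rw [← volumeReal_closedBall_sub p (p - y), sub_sub_cancel]
  have hpos : 0 < volume.real (closedBall p r) :=
    ENNReal.toReal_pos (measure_closedBall_pos _ _ hr).ne' measure_closedBall_lt_top.ne
  rw [e1, e2, hvol] at hmono
  rw [greenFunction_of_ne (hp hyp) hx (hne y hyp), greenFunction_of_ne (hp hpp) hx (hne p hpp),
    ← ENNReal.ofReal_mul (by positivity)]
  refine ENNReal.ofReal_le_ofReal ?_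
  rw [div_mul_eq_mul_div, le_div_iff₀ hpos]
  linarith

/-- Translating the pole to the origin moves the ball into one fixed ball of radius `2 * r`, so the
bound is uniform in `y`. -/
theorem lintegral_newtonKernel_le (p y : EuclideanSpace ℝ (Fin n)) {r : ℝ}
    (hy : y ∈ closedBall p r) :
    ∫⁻ x in closedBall p r, ENNReal.ofReal (newtonKernel (y - x)) ≤
      ∫⁻ x in closedBall (0 : EuclideanSpace ℝ (Fin n)) (2 * r),
        ENNReal.ofReal (newtonKernel x) := by
  have e : ∫⁻ x in closedBall p r, ENNReal.ofReal (newtonKernel (y - x)) =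
      ∫⁻ x in closedBall (p - y) r, ENNReal.ofReal (newtonKernel x) := by
    rw [← (measurePreserving_sub_right volume y).setLIntegral_comp_preimage_emb
      (measurableEmbedding_subRight y) (fun x => ENNReal.ofReal (newtonKernel x))]
    have : (fun z => z - y) ⁻¹' closedBall (p - y) r = closedBall p r := by
      ext z
      simp
    rw [this]
    simp_rw [newtonKernel_sub_comm y]
  rw [e]
  refine lintegral_mono_set (closedBall_subset_closedBall' ?_)
  rw [dist_zero_right, ← dist_eq_norm, dist_comm]
  rw [mem_closedBall] at hy
  linarith

/-- The Green potential of Lebesgue measure on `D` is locally bounded near a point where it is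
finite. -/
theorem exists_greenPotential_le (hn : 2 ≤ n) (hK : IsGreenian K)
    {D : Set (EuclideanSpace ℝ (Fin n))} (hD : IsOpen D) (hDK : D ⊆ K)
    {p : EuclideanSpace ℝ (Fin n)} (hp : p ∈ K)
    (hfin : greenPotential K (volume.restrict D) p ≠ ⊤) :
    ∃ r : ℝ, 0 < r ∧ ∃ M : ENNReal, M ≠ ⊤ ∧ ∀ y ∈ closedBall p r,
      greenPotential K (volume.restrict D) y ≤ M := by
  have : Nonempty (Fin n) := ⟨⟨0, by omega⟩⟩
  obtain ⟨R, hR, hRK⟩ := Metric.nhds_basis_closedBall.mem_iff.1 (hK.1.mem_nhds hp)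
  set r := R / 2 with hrdef
  have hr : 0 < r := by positivity
  have hR2 : R = 2 * r := by rw [hrdef]; ring
  rw [hR2] at hRK
  let B := closedBall p (2 * r)
  have hBc : IsCompact B := isCompact_closedBall _ _
  have hBm : MeasurableSet B := measurableSet_closedBall
  obtain ⟨A, hA⟩ := (hBc.prod hBc).exists_bound_of_continuousOn
    ((continuousOn_uncurry_greatest hn hK.1 hK.isGreatest).mono (prod_mono hRK hRK))
  let c := ENNReal.ofReal (volume.real (closedBall p (2 * r)) / volume.real (closedBall p r))
  let N := ∫⁻ x in closedBall (0 : EuclideanSpace ℝ (Fin n)) (2 * (2 * r)),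
        ENNReal.ofReal (newtonKernel x)
  refine ⟨r, hr, (N + ENNReal.ofReal A * volume B) +
    c * greenPotential K (volume.restrict D) p, ?_, fun y hy => ?_⟩
  · refine ENNReal.add_ne_top.2 ⟨ENNReal.add_ne_top.2 ⟨?_, ?_⟩, ?_⟩
    · exact (integrableOn_newtonKernel hn _ _).lintegral_lt_top.ne
    · exact ENNReal.mul_ne_top ENNReal.ofReal_ne_top hBc.measure_lt_top.ne
    · exact ENNReal.mul_ne_top ENNReal.ofReal_ne_top hfin
  have hyB : y ∈ B := closedBall_subset_closedBall (by linarith) hy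
  have hyK : y ∈ K := hRK hyB
  unfold greenPotential
  -- Inside `B` the kernel is uniformly integrated and the regular part is bounded by `A`; outside
  -- `B`, Harnack compares the pole `y` with `p`, where the potential is finite.
  rw [← lintegral_inter_add_sdiff (μ := volume) (fun x => greenFunction K y x) D hBm]
  refine add_le_add ?_ ?_
  · refine (lintegral_mono_set inter_subset_right).trans ?_
    calc ∫⁻ x in B, greenFunction K y x
        ≤ ∫⁻ x in B, (ENNReal.ofReal (newtonKernel (y - x)) + ENNReal.ofReal A) := by
          refine lintegral_mono_ae ?_
          have hne : ∀ᵐ x ∂(volume.restrict B), x ≠ y := Measure.ae_ne _ _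
          filter_upwards [hne, ae_restrict_mem hBm] with x hx hxB
          rw [greenFunction_of_ne hyK (hRK hxB) hx.symm]
          refine (ENNReal.ofReal_le_ofReal ?_).trans ENNReal.ofReal_add_le
          have := (abs_le.1 (hA (x, y) ⟨hxB, hyB⟩)).1
          simp only [Function.uncurry] at this
          linarith
      _ ≤ N + ENNReal.ofReal A * volume B := by
          rw [lintegral_add_right _ measurable_const, setLIntegral_const]
          exact add_le_add_left (lintegral_newtonKernel_le p y hyB) _
  · calc ∫⁻ x in D \ B, greenFunction K y x
        ≤ ∫⁻ x in D \ B, c * greenFunction K p x := by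
          refine setLIntegral_mono' (hD.measurableSet.diff hBm) fun x hx => ?_
          exact greenFunction_harnack hn hK hr hRK (hDK hx.1) hx.2 hy
      _ = c * ∫⁻ x in D \ B, greenFunction K p x :=
          lintegral_const_mul _ (measurable_greenFunction_left hn hK p)
      _ ≤ _ := by
          gcongr
          exact sdiff_subset

end Green

/-! ### Extended real differences under the convention ∞ - ∞ = -∞ -/

section EReal

/-- Subtracting `⊤` always gives `⊥`, so a vanishing difference forces finiteness besides equality.
-/
theorem ereal_coe_sub_eq_zero_iff {a b : ENNReal} :
    (a : EReal) - (b : EReal) = 0 ↔ a = b ∧ b ≠ ⊤ := by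
  constructor
  · intro h
    have hb : b ≠ ⊤ := by
      rintro rfl
      rw [EReal.coe_ennreal_top, EReal.sub_top] at h
      exact absurd h.symm EReal.zero_ne_bot
    have ha : a ≠ ⊤ := by
      rintro rfl
      lift b to NNReal using hb
      rw [EReal.coe_ennreal_top, EReal.coe_nnreal_eq_coe_real, EReal.top_sub_coe] at h
      exact absurd h.symm EReal.zero_ne_top
    lift a to NNReal using ha
    lift b to NNReal using hb
    refine ⟨?_, ENNReal.coe_ne_top⟩
    rw [EReal.coe_nnreal_eq_coe_real, EReal.coe_nnreal_eq_coe_real, ← EReal.coe_sub] at h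
    have h2 : (a : ℝ) - b = 0 := by exact_mod_cast h
    exact ENNReal.coe_inj.2 (NNReal.coe_injective (sub_eq_zero.1 h2))
  · rintro ⟨rfl, ha⟩
    lift a to NNReal using ha
    rw [EReal.coe_nnreal_eq_coe_real, ← EReal.coe_sub, sub_self, EReal.coe_zero]

theorem ereal_zero_le_coe_sub_iff {a b : ENNReal} :
    0 ≤ (a : EReal) - (b : EReal) ↔ b ≤ a ∧ b ≠ ⊤ := by
  constructor
  · intro h
    have hb : b ≠ ⊤ := by
      rintro rfl
      rw [EReal.coe_ennreal_top, EReal.sub_top] at h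
      exact absurd h (not_le.2 EReal.bot_lt_zero)
    refine ⟨?_, hb⟩
    lift b to NNReal using hb
    rw [EReal.coe_nnreal_eq_coe_real] at h
    rw [EReal.sub_nonneg (Or.inr (EReal.coe_ne_top _)) (Or.inr (EReal.coe_ne_bot _))] at h
    rw [← EReal.coe_ennreal_le_coe_ennreal_iff, EReal.coe_nnreal_eq_coe_real]
    exact h
  · rintro ⟨h, hb⟩
    lift b to NNReal using hb
    rw [EReal.coe_nnreal_eq_coe_real]
    rw [EReal.sub_nonneg (Or.inr (EReal.coe_ne_top _)) (Or.inr (EReal.coe_ne_bot _))]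
    rw [← EReal.coe_ennreal_le_coe_ennreal_iff, EReal.coe_nnreal_eq_coe_real] at h
    exact h

theorem ereal_coe_mul_coe {α : ℝ} (hα : 0 < α) (a : ENNReal) :
    (α : EReal) * (a : EReal) = ((ENNReal.ofReal α * a : ENNReal) : EReal) := by
  rw [EReal.coe_ennreal_mul, EReal.coe_ennreal_ofReal, max_eq_left hα.le]

end EReal

/-! ### Integrals of differences of nonnegative functions -/

section Integrals

variable {X : Type*} [MeasurableSpace X] {μ : Measure X}

/-- Finite integrals make both functions finite almost everywhere, so the convention for `∞ - ∞` is
invisible and the real-valued theory applies. -/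
theorem eintegrable_coe_sub_coe {A B : X → ENNReal} (hA : AEMeasurable A μ)
    (hB : AEMeasurable B μ) (hAf : ∫⁻ x, A x ∂μ ≠ ⊤) (hBf : ∫⁻ x, B x ∂μ ≠ ⊤) :
    EIntegrable (fun x => (A x : EReal) - (B x : EReal)) μ ∧
      eintegral (fun x => (A x : EReal) - (B x : EReal)) μ =
        ((∫⁻ x, A x ∂μ : ENNReal) : EReal) - ((∫⁻ x, B x ∂μ : ENNReal) : EReal) := by
  have hae : (fun x => (A x : EReal) - (B x : EReal)) =ᵐ[μ]
      fun x => (((A x).toReal - (B x).toReal : ℝ) : EReal) := by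
    filter_upwards [ae_lt_top' hA hAf, ae_lt_top' hB hBf] with x h1 h2
    rw [EReal.coe_sub, EReal.coe_ennreal_toReal h1.ne, EReal.coe_ennreal_toReal h2.ne]
  have iA := integrable_toReal_of_lintegral_ne_top hA hAf
  have iB := integrable_toReal_of_lintegral_ne_top hB hBf
  have e := eintegral_coe (iA.sub iB)
  refine ⟨⟨?_, ?_, ?_⟩, ?_⟩
  · exact ((iA.sub iB).aemeasurable.coe_real_ereal).congr hae.symm
  · have : ∫⁻ x, ((A x : EReal) - (B x : EReal)).toENNReal ∂μ =
        ∫⁻ x, ENNReal.ofReal ((A x).toReal - (B x).toReal) ∂μ :=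
      lintegral_congr_ae (by filter_upwards [hae] with x hx; rw [hx, EReal.real_coe_toENNReal])
    rw [this]
    exact (iA.sub iB).lintegral_lt_top.ne
  · have : ∫⁻ x, (-((A x : EReal) - (B x : EReal))).toENNReal ∂μ =
        ∫⁻ x, ENNReal.ofReal (-((A x).toReal - (B x).toReal)) ∂μ :=
      lintegral_congr_ae (by
        filter_upwards [hae] with x hx
        rw [hx, ← EReal.coe_neg, EReal.real_coe_toENNReal])
    rw [this]
    exact (iA.sub iB).neg.lintegral_lt_top.ne
  · rw [eintegral_congr_ae hae]
    refine e.trans ?_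
    simp only [Pi.sub_apply]
    rw [integral_sub iA iB, integral_toReal hA (ae_lt_top' hA hAf),
      integral_toReal hB (ae_lt_top' hB hBf), EReal.coe_sub, EReal.coe_ennreal_toReal hAf,
      EReal.coe_ennreal_toReal hBf]

theorem eintegral_coe_ennreal (A : X → ENNReal) :
    eintegral (fun x => (A x : EReal)) μ = ((∫⁻ x, A x ∂μ : ENNReal) : EReal) := by
  have h : ∀ x, (-(A x : EReal)).toENNReal = 0 := fun x =>
    EReal.toENNReal_of_nonpos (EReal.neg_le_zero.2 (EReal.coe_ennreal_nonneg _))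
  simp only [eintegral, h, EReal.toENNReal_coe]
  simp

theorem eintegral_neg_coe_ennreal (A : X → ENNReal) :
    eintegral (fun x => -(A x : EReal)) μ = -((∫⁻ x, A x ∂μ : ENNReal) : EReal) := by
  have h : ∀ x, (-(A x : EReal)).toENNReal = 0 := fun x =>
    EReal.toENNReal_of_nonpos (EReal.neg_le_zero.2 (EReal.coe_ennreal_nonneg _))
  simp only [eintegral, h, neg_neg, EReal.toENNReal_coe]
  simp

end Integrals

/-! ### Test measures and Jordan decompositions -/

section Measures

variable {n : ℕ} {K D : Set (EuclideanSpace ℝ (Fin n))}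

theorem toJordanDecomposition_toSignedMeasure {X : Type*} [MeasurableSpace X] (ν : Measure X)
    [IsFiniteMeasure ν] : ν.toSignedMeasure.toJordanDecomposition.posPart = ν ∧
      ν.toSignedMeasure.toJordanDecomposition.negPart = 0 := by
  let j : JordanDecomposition X :=
    { posPart := ν
      negPart := 0
      posPart_finite := inferInstance
      negPart_finite := inferInstance
      mutuallySingular := Measure.MutuallySingular.zero_right }
  have h : ν.toSignedMeasure.toJordanDecomposition = j :=
    SignedMeasure.toJordanDecomposition_eq (by simp [j, JordanDecomposition.toSignedMeasure])
  rw [h]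
  exact ⟨rfl, rfl⟩

theorem signedGreenPotential_dirac (y : EuclideanSpace ℝ (Fin n)) :
    signedGreenPotential K (Measure.dirac y).toSignedMeasure =
      fun x => (greenFunction K x y : EReal) := by
  ext x
  obtain ⟨h1, h2⟩ := toJordanDecomposition_toSignedMeasure (Measure.dirac y)
  simp [signedGreenPotential, h1, h2, greenPotential]

theorem signedGreenPotential_neg_dirac (y : EuclideanSpace ℝ (Fin n)) :
    signedGreenPotential K (-(Measure.dirac y).toSignedMeasure) =
      fun x => -(greenFunction K x y : EReal) := by
  ext x
  obtain ⟨h1, h2⟩ := toJordanDecomposition_toSignedMeasure (Measure.dirac y)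
  simp [signedGreenPotential, SignedMeasure.toJordanDecomposition_neg, h1, h2, greenPotential]

theorem hasCompactSupportIn_dirac {S : Set (EuclideanSpace ℝ (Fin n))}
    {y : EuclideanSpace ℝ (Fin n)} (hy : y ∈ S) :
    HasCompactSupportIn (Measure.dirac y).toSignedMeasure S := by
  refine ⟨{y}, isCompact_singleton, singleton_subset_iff.2 hy, ?_⟩
  obtain ⟨h1, h2⟩ := toJordanDecomposition_toSignedMeasure (Measure.dirac y)
  simp [SignedMeasure.totalVariation, h1, h2]

theorem HasCompactSupportIn.neg {S : Set (EuclideanSpace ℝ (Fin n))}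
    {μ : SignedMeasure (EuclideanSpace ℝ (Fin n))} (h : HasCompactSupportIn μ S) :
    HasCompactSupportIn (-μ) S := by
  obtain ⟨C, h1, h2, h3⟩ := h
  exact ⟨C, h1, h2, by rwa [SignedMeasure.totalVariation_neg]⟩

theorem restrict_neg_toSignedMeasure_nonpos {X : Type*} [MeasurableSpace X] (ν : Measure X)
    [IsFiniteMeasure ν] {D : Set X} (hD : MeasurableSet D) :
    (-ν.toSignedMeasure).restrict D ≤ 0 := by
  intro i hi
  rw [VectorMeasure.restrict_apply _ hD hi]
  simp [Measure.toSignedMeasure_apply_measurable (hi.inter hD)]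

theorem restrict_dirac_nonpos {X : Type*} [MeasurableSpace X] [MeasurableSingletonClass X]
    {y : X} {D : Set X} (hD : MeasurableSet D) (hy : y ∉ D) :
    ((Measure.dirac y).toSignedMeasure).restrict D ≤ 0 := by
  intro i hi
  rw [VectorMeasure.restrict_apply _ hD hi]
  simp [Measure.toSignedMeasure_apply_measurable (hi.inter hD), Measure.real, hy]

/-- On a positive Hahn set `i` the value `μ (i ∩ D)` is nonnegative, and it is nonpositive by
hypothesis. -/
theorem posPart_eq_zero_of_restrict_nonpos {X : Type*} [MeasurableSpace X] (μ : SignedMeasure X)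
    {D : Set X} (hD : MeasurableSet D) (h : μ.restrict D ≤ 0) :
    μ.toJordanDecomposition.posPart D = 0 := by
  obtain ⟨i, hi, hi2, hi3, hp, -⟩ := μ.toJordanDecomposition_spec
  rw [hp, SignedMeasure.toMeasureOfZeroLE_apply _ hi2 hi hD]
  have h1 := h i hi
  rw [VectorMeasure.restrict_apply _ hD hi] at h1
  have h2 : 0 ≤ μ (i ∩ D) := VectorMeasure.nonneg_of_zero_le_restrict _
    (VectorMeasure.zero_le_restrict_subset μ hi inter_subset_left hi2)
  have h3 : μ (i ∩ D) = 0 := le_antisymm (by simpa using h1) h2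
  simp [h3]

theorem lintegral_ne_top_of_le_on {X : Type*} [MeasurableSpace X] {ν : Measure X}
    [IsFiniteMeasure ν] {C : Set X} (hν : ν Cᶜ = 0) {f : X → ENNReal} {M : ENNReal} (hM : M ≠ ⊤)
    (h : ∀ x ∈ C, f x ≤ M) : ∫⁻ x, f x ∂ν ≠ ⊤ := by
  refine ne_top_of_le_ne_top (b := ∫⁻ _, M ∂ν) ?_ (lintegral_mono_ae ?_)
  · rw [lintegral_const]
    exact ENNReal.mul_ne_top hM (measure_ne_top _ _)
  · filter_upwards [measure_eq_zero_iff_ae_notMem.1 hν] with x hx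
    exact h x (not_not.1 hx)

end Measures

/-! ### The two characterisations -/

section Main

variable {n : ℕ} {K D : Set (EuclideanSpace ℝ (Fin n))} {x₀ : EuclideanSpace ℝ (Fin n)} {α : ℝ}

theorem ballPotential_eq (hα : 0 < α) (x : EuclideanSpace ℝ (Fin n)) :
    ballPotential K D x₀ α x =
      ((ENNReal.ofReal α * greenFunction K x₀ x : ENNReal) : EReal) -
        (greenPotential K (volume.restrict D) x : EReal) := by
  rw [ballPotential, ereal_coe_mul_coe hα]

theorem setLIntegral_greenFunction_pole (hn : 2 ≤ n) (hK : IsGreenian K)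
    (y : EuclideanSpace ℝ (Fin n)) :
    ∫⁻ x in D, greenFunction K x y = greenPotential K (volume.restrict D) y := by
  unfold greenPotential
  simp_rw [greenFunction_comm hn hK]

/-- The Green function is infinite at its pole, while a zero of the ball potential requires finite
terms. -/
theorem mem_of_ballPotential_eq_zero (hx₀ : x₀ ∈ K) (hα : 0 < α)
    (h : ∀ x ∈ K \ D, ballPotential K D x₀ α x = 0) : x₀ ∈ D := by
  by_contra hx
  have := h x₀ ⟨hx₀, hx⟩
  rw [ballPotential_eq hα, ereal_coe_sub_eq_zero_iff, greenFunction_self hx₀,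
    ENNReal.mul_top (ENNReal.ofReal_pos.2 hα).ne'] at this
  exact this.2 this.1.symm

/-- Integration of the potential of Lebesgue measure against a measure carried by a compact set
on which it is a multiple of the Green function. -/
theorem lintegral_greenPotential_eq (hn : 2 ≤ n) (hK : IsGreenian K) (hx₀ : x₀ ∈ K)
    {ν : Measure (EuclideanSpace ℝ (Fin n))} [IsFiniteMeasure ν]
    {C : Set (EuclideanSpace ℝ (Fin n))} (hC : IsCompact C) (hCK : C ⊆ K) (hxC : x₀ ∉ C)
    (hν : ν Cᶜ = 0) (hα : 0 < α)
    (h : ∀ y ∈ C, ballPotential K D x₀ α y = 0) :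
    ∫⁻ x in D, greenPotential K ν x = ENNReal.ofReal α * greenPotential K ν x₀ ∧
      greenPotential K ν x₀ ≠ ⊤ := by
  constructor
  · rw [lintegral_greenPotential_comm hn hK]
    unfold greenPotential
    rw [← lintegral_const_mul _ (measurable_greenFunction_left hn hK x₀)]
    refine lintegral_congr_ae ?_
    filter_upwards [measure_eq_zero_iff_ae_notMem.1 hν] with y hy
    have := h y (not_not.1 hy)
    rw [ballPotential_eq hα, ereal_coe_sub_eq_zero_iff] at this
    exact this.1.symm
  · obtain ⟨M, hM, hle⟩ := exists_greenFunction_le hK hn hx₀ hC hCK hxC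
    exact lintegral_ne_top_of_le_on hν hM hle

/-- Evaluates the test with the measure $-\delta_y$; integrability is what supplies finiteness. -/
theorem greenPotential_le_of_mul_neg_le {y : EuclideanSpace ℝ (Fin n)} (hn : 2 ≤ n)
    (hK : IsGreenian K) (hα : 0 < α)
    (hint : EIntegrable (fun x => -(greenFunction K x y : EReal)) (volume.restrict D))
    (h : (α : EReal) * -(greenFunction K x₀ y : EReal) ≤
      eintegral (fun x => -(greenFunction K x y : EReal)) (volume.restrict D)) :
    greenPotential K (volume.restrict D) y ≤ ENNReal.ofReal α * greenFunction K x₀ y ∧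
      greenPotential K (volume.restrict D) y ≠ ⊤ := by
  rw [eintegral_neg_coe_ennreal, setLIntegral_greenFunction_pole hn hK, mul_neg,
    ereal_coe_mul_coe hα, EReal.neg_le_neg_iff, EReal.coe_ennreal_le_coe_ennreal_iff] at h
  refine ⟨h, ?_⟩
  rw [← setLIntegral_greenFunction_pole hn hK]
  simpa using hint.2.2

theorem isHarmonicBall_iff (hn : 2 ≤ n) (hK : IsGreenian K) (hx₀ : x₀ ∈ K) (hα : 0 < α)
    (hDK : D ⊆ K) :
    IsHarmonicBall K D x₀ α ↔ ∀ x ∈ K \ D, ballPotential K D x₀ α x = 0 := by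
  constructor
  · rintro ⟨-, h⟩ y hy
    obtain ⟨h1, h2⟩ := h _ ⟨_, hasCompactSupportIn_dirac hy, rfl⟩
    rw [signedGreenPotential_dirac] at h1 h2
    rw [eintegral_coe_ennreal, setLIntegral_greenFunction_pole hn hK, ereal_coe_mul_coe hα,
      EReal.coe_ennreal_eq_coe_ennreal_iff] at h2
    rw [ballPotential_eq hα, ereal_coe_sub_eq_zero_iff]
    refine ⟨h2.symm, ?_⟩
    rw [← setLIntegral_greenFunction_pole hn hK]
    simpa using h1.2.1
  · intro h
    refine ⟨hDK, ?_⟩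
    rintro _ ⟨μ, ⟨C, hC, hCS, hμ⟩, rfl⟩
    have hxD := mem_of_ballPotential_eq_zero hx₀ hα h
    -- The pole is off the support, so both potentials are finite at `x₀` and no indeterminate
    -- difference occurs there.
    have hxC : x₀ ∉ C := fun hx => (hCS hx).2 hxD
    have hCK : C ⊆ K := hCS.trans sdiff_subset
    rw [SignedMeasure.totalVariation, Measure.add_apply, add_eq_zero] at hμ
    obtain ⟨e1, f1⟩ := lintegral_greenPotential_eq hn hK hx₀ hC hCK hxC hμ.1 hα
      fun y hy => h y (hCS hy)
    obtain ⟨e2, f2⟩ := lintegral_greenPotential_eq hn hK hx₀ hC hCK hxC hμ.2 hα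
      fun y hy => h y (hCS hy)
    obtain ⟨i, e⟩ := eintegrable_coe_sub_coe (μ := volume.restrict D)
      (measurable_greenPotential hn hK μ.toJordanDecomposition.posPart).aemeasurable
      (measurable_greenPotential hn hK μ.toJordanDecomposition.negPart).aemeasurable
      (by rw [e1]; exact ENNReal.mul_ne_top ENNReal.ofReal_ne_top f1)
      (by rw [e2]; exact ENNReal.mul_ne_top ENNReal.ofReal_ne_top f2)
    refine ⟨i, e.trans ?_⟩
    rw [e1, e2, ← ereal_coe_mul_coe hα, ← ereal_coe_mul_coe hα, signedGreenPotential]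
    lift greenPotential K μ.toJordanDecomposition.posPart x₀ to NNReal using f1 with p
    lift greenPotential K μ.toJordanDecomposition.negPart x₀ to NNReal using f2 with q
    rw [EReal.coe_nnreal_eq_coe_real, EReal.coe_nnreal_eq_coe_real]
    norm_cast
    ring

theorem isSubharmonicBall_iff (hn : 2 ≤ n) (hK : IsGreenian K) (hx₀ : x₀ ∈ K) (hα : 0 < α)
    (hD : IsOpen D) (hDK : D ⊆ K) :
    IsSubharmonicBall K D x₀ α ↔ (∀ x ∈ K, 0 ≤ ballPotential K D x₀ α x) ∧
      ∀ x ∈ K \ D, ballPotential K D x₀ α x = 0 := by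
  constructor
  · rintro ⟨-, h⟩
    have hle : ∀ y ∈ K, greenPotential K (volume.restrict D) y ≤
        ENNReal.ofReal α * greenFunction K x₀ y ∧
          greenPotential K (volume.restrict D) y ≠ ⊤ := by
      intro y hy
      obtain ⟨h1, h2⟩ := h _ ⟨_, (hasCompactSupportIn_dirac hy).neg,
        restrict_neg_toSignedMeasure_nonpos _ hD.measurableSet, rfl⟩
      rw [signedGreenPotential_neg_dirac] at h1 h2
      exact greenPotential_le_of_mul_neg_le hn hK hα h1 h2
    refine ⟨fun y hy => ?_, fun y hy => ?_⟩
    · rw [ballPotential_eq hα, ereal_zero_le_coe_sub_iff]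
      exact hle y hy
    · obtain ⟨-, h2⟩ := h _ ⟨_, hasCompactSupportIn_dirac hy.1,
        restrict_dirac_nonpos hD.measurableSet hy.2, rfl⟩
      rw [signedGreenPotential_dirac, eintegral_coe_ennreal,
        setLIntegral_greenFunction_pole hn hK, ereal_coe_mul_coe hα,
        EReal.coe_ennreal_le_coe_ennreal_iff] at h2
      rw [ballPotential_eq hα, ereal_coe_sub_eq_zero_iff]
      exact ⟨le_antisymm h2 (hle y hy.1).1, (hle y hy.1).2⟩
  · rintro ⟨hpos, h⟩
    refine ⟨hDK, ?_⟩
    rintro _ ⟨μ, ⟨C, hC, hCK, hμ⟩, hμD, rfl⟩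
    have hxD := mem_of_ballPotential_eq_zero hx₀ hα h
    have hle : ∀ y ∈ K, greenPotential K (volume.restrict D) y ≤
        ENNReal.ofReal α * greenFunction K x₀ y ∧
          greenPotential K (volume.restrict D) y ≠ ⊤ := by
      intro y hy
      have := hpos y hy
      rwa [ballPotential_eq hα, ereal_zero_le_coe_sub_iff] at this
    rw [SignedMeasure.totalVariation, Measure.add_apply, add_eq_zero] at hμ
    -- The positive part lives on the compact set `C \ D`, away from `x₀`, and is treated as in the
    -- harmonic case; only the negative part can charge `D`.
    have hpos' : μ.toJordanDecomposition.posPart (C \ D)ᶜ = 0 := by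
      refine measure_mono_null (t := Cᶜ ∪ D) ?_ (measure_union_null hμ.1
        (posPart_eq_zero_of_restrict_nonpos μ hD.measurableSet hμD))
      intro z hz
      by_cases hzC : z ∈ C
      · exact Or.inr (by_contra fun hzD => hz ⟨hzC, hzD⟩)
      · exact Or.inl hzC
    obtain ⟨e1, f1⟩ := lintegral_greenPotential_eq hn hK hx₀ (hC.diff hD)
      (sdiff_subset.trans hCK) (fun hx => hx.2 hxD) hpos' hα
      fun y hy => h y ⟨hCK hy.1, hy.2⟩
    have e2 : ∫⁻ x in D, greenPotential K μ.toJordanDecomposition.negPart x ≤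
        ENNReal.ofReal α * greenPotential K μ.toJordanDecomposition.negPart x₀ := by
      rw [lintegral_greenPotential_comm hn hK, greenPotential,
        ← lintegral_const_mul _ (measurable_greenFunction_left hn hK x₀)]
      refine lintegral_mono_ae ?_
      filter_upwards [measure_eq_zero_iff_ae_notMem.1 hμ.2] with y hy
      exact (hle y (hCK (not_not.1 hy))).1
    -- The bound `e2` may be infinite, so finiteness is argued separately: near `x₀` by local
    -- boundedness of the potential of Lebesgue measure, on the rest of `C` by boundedness of the
    -- Green function.
    have f2 : ∫⁻ x in D, greenPotential K μ.toJordanDecomposition.negPart x ≠ ⊤ := by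
      rw [lintegral_greenPotential_comm hn hK]
      obtain ⟨r, hr, M, hM, hMle⟩ := exists_greenPotential_le hn hK hD hDK hx₀ (hle x₀ hx₀).2
      obtain ⟨M', hM', hMle'⟩ := exists_greenFunction_le hK hn hx₀
        (hC.diff (isOpen_ball (x := x₀) (ε := r))) (sdiff_subset.trans hCK)
        (fun hx => hx.2 (mem_ball_self hr))
      refine lintegral_ne_top_of_le_on hμ.2 (M := M + ENNReal.ofReal α * M')
        (ENNReal.add_ne_top.2 ⟨hM, ENNReal.mul_ne_top ENNReal.ofReal_ne_top hM'⟩) fun y hy => ?_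
      by_cases hyb : y ∈ ball x₀ r
      · exact (hMle y (ball_subset_closedBall hyb)).trans le_self_add
      · refine ((hle y (hCK hy)).1.trans ?_).trans le_add_self
        gcongr
        exact hMle' y ⟨hy, hyb⟩
    obtain ⟨i, e⟩ := eintegrable_coe_sub_coe (μ := volume.restrict D)
      (measurable_greenPotential hn hK μ.toJordanDecomposition.posPart).aemeasurable
      (measurable_greenPotential hn hK μ.toJordanDecomposition.negPart).aemeasurable
      (by rw [e1]; exact ENNReal.mul_ne_top ENNReal.ofReal_ne_top f1) f2
    refine ⟨i, le_of_le_of_eq ?_ e.symm⟩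
    rw [e1, signedGreenPotential]
    -- If the negative potential is infinite at `x₀`, the left side is `⊥` and nothing remains to
    -- prove.
    by_cases f3 : greenPotential K μ.toJordanDecomposition.negPart x₀ = ⊤
    · rw [f3, EReal.coe_ennreal_top, EReal.sub_top, EReal.coe_mul_bot_of_pos hα]
      exact bot_le
    refine le_trans (le_of_eq ?_) (EReal.sub_le_sub le_rfl
      (EReal.coe_ennreal_le_coe_ennreal_iff.2 e2))
    rw [← ereal_coe_mul_coe hα, ← ereal_coe_mul_coe hα]
    lift greenPotential K μ.toJordanDecomposition.posPart x₀ to NNReal using f1 with p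
    lift greenPotential K μ.toJordanDecomposition.negPart x₀ to NNReal using f3 with q
    rw [EReal.coe_nnreal_eq_coe_real, EReal.coe_nnreal_eq_coe_real]
    norm_cast
    ring

end Main

end PotentialTheory

end

theorem mainTheorem1 (n : ℕ) (hn : 2 ≤ n) (K : Set (EuclideanSpace ℝ (Fin n)))
    (hK : PotentialTheory.IsGreenian K) (hKc : IsConnected K)
    (x₀ : EuclideanSpace ℝ (Fin n)) (hx₀ : x₀ ∈ K) (α : ℝ) (hα : 0 < α)
    (D : Set (EuclideanSpace ℝ (Fin n))) (hD : IsOpen D) (hDK : D ⊆ K) :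
    (PotentialTheory.IsHarmonicBall K D x₀ α ↔
      ∀ x ∈ K \ D, PotentialTheory.ballPotential K D x₀ α x = 0) ∧
    (PotentialTheory.IsSubharmonicBall K D x₀ α ↔
      (∀ x ∈ K, 0 ≤ PotentialTheory.ballPotential K D x₀ α x) ∧
        ∀ x ∈ K \ D, PotentialTheory.ballPotential K D x₀ α x = 0) := by
  exact ⟨PotentialTheory.isHarmonicBall_iff hn hK hx₀ hα hDK,
    PotentialTheory.isSubharmonicBall_iff hn hK hx₀ hα hD hDK⟩
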